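/- Let $p$ be an odd prime and let $k \ge 1$ be an integer. Let $F$ be the free pro-$p$ group on two generators $\tilde x, \tilde y$; all subgroups of $F$ are understood to be closed. Let $W_k = C_p \wr C_{p^k}$ be the (restricted regular) wreath product with top group $\langle \dot x_k \rangle \cong C_{p^k}$ and elementary abelian base group $B_k = \prod_{j=0}^{p^k-1} \langle \dot y_k^{\,\dot x_k^{\,j}} \rangle \cong C_p^{\,p^k}$, where $\dot y_k$ generates one coordinate factor of the base group. Let $\eta_k \colon F \to W_k$ be the continuous epimorphism with $\tilde x \mapsto \dot x_k$ and $\tilde y \mapsto \dot y_k$, let $R_k = \ker \eta_k$ and $Y_k = \eta_k^{-1}(B_k)$, and put $$G_k = F/N_k, \qquad N_k = [R_k, Y_k]\, Y_k^{\,p}\, \langle \tilde x^{p^k} \rangle^F ,$$ where $Y_k^{\,p}$ is the subgroup generated by all $p$-th powers of elements of $Y_k$ and $\langle \tilde x^{p^k} \rangle^F$ is the normal closure of $\tilde x^{p^k}$ in $F$. Let $x_k$ denote the image of $\tilde x$ in $G_k$. Let $\gamma_1(G_k) \ge \gamma_2(G_k) \ge \cdots$ be the lower central series of $G_k$ (so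 $\gamma_1(G_k) = G_k$), and let the lower $p$-series of $G_k$ be defined by $P_1(G_k) = G_k$ and $P_i(G_k) = P_{i-1}(G_k)^p\,[P_{i-1}(G_k), G_k]$ for $i \ge 2$. Then the lower $p$-series of $G_k$ has length $2p^k - 1$, that is, $2p^k-1$ is the least integer $n \ge 0$ with $P_{n+1}(G_k) = 1$. Moreover, for all $1 \le i \le 2p^k - 1$, $$P_i(G_k) = \langle x_k^{\,p^{i-1}} \rangle\, \gamma_i(G_k).$$ -/

import Mathlib

namespace ProPWreath

/-- The normal subgroups of `p`-power index in the (abstract) free group on two generators. -/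
def PIndexNormal (p : ℕ) : Type :=
  {N : Subgroup (FreeGroup (Fin 2)) // N.Normal ∧ ∃ n : ℕ, N.index = p ^ n}

instance (p : ℕ) (N : PIndexNormal p) : N.1.Normal := N.2.1

/-- The finite `p`-group quotient of the free group on two generators by `N`, regarded as a
discrete topological group. -/
def PQuotient {p : ℕ} (N : PIndexNormal p) : Type := FreeGroup (Fin 2) ⧸ N.1

instance {p : ℕ} (N : PIndexNormal p) : Group (PQuotient N) :=
  inferInstanceAs (Group (FreeGroup (Fin 2) ⧸ N.1))

instance {p : ℕ} (N : PIndexNormal p) : TopologicalSpace (PQuotient N) := ⊥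

instance {p : ℕ} (N : PIndexNormal p) : DiscreteTopology (PQuotient N) := ⟨rfl⟩

/-- The projection of the abstract free group onto one of its finite `p`-group quotients. -/
def PQuotient.mk {p : ℕ} (N : PIndexNormal p) : FreeGroup (Fin 2) →* PQuotient N :=
  QuotientGroup.mk' N.1

/-- The transition homomorphism between two finite `p`-group quotients. -/
def PQuotient.transition {p : ℕ} {M N : PIndexNormal p} (h : M.1 ≤ N.1) :
    PQuotient M →* PQuotient N :=
  QuotientGroup.map M.1 N.1 (MonoidHom.id _) h

/-- The compatible families of elements of the finite `p`-group quotients of the free group on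
two generators, as a subgroup of the product of all these quotients. -/
def compatibleFamilies (p : ℕ) : Subgroup ((N : PIndexNormal p) → PQuotient N) where
  carrier := {f | ∀ (M N : PIndexNormal p) (h : M.1 ≤ N.1), PQuotient.transition h (f M) = f N}
  mul_mem' := by
    intro f g hf hg M N h
    rw [Pi.mul_apply, map_mul, hf M N h, hg M N h, Pi.mul_apply]
  one_mem' := by
    intro M N h
    simp
  inv_mem' := by
    intro f hf M N h
    rw [Pi.inv_apply, map_inv, hf M N h, Pi.inv_apply]

/-- The free pro-`p` group on two generators: the inverse limit of all finite `p`-group quotients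
of the abstract free group on two generators (its pro-`p` completion). Its topology is the one
induced by the product of the discrete topologies. -/
abbrev FreeProP (p : ℕ) : Type := compatibleFamilies p

/-- The canonical homomorphism from the abstract free group on two generators to the free
pro-`p` group. -/
def FreeProP.of (p : ℕ) : FreeGroup (Fin 2) →* FreeProP p where
  toFun w := ⟨fun N => PQuotient.mk N w, fun _ _ _ => rfl⟩
  map_one' := rfl
  map_mul' _ _ := rfl

/-- The first free generator of the free pro-`p` group. -/
def xTilde (p : ℕ) : FreeProP p := FreeProP.of p (FreeGroup.of 0)

/-- The second free generator of the free pro-`p` group. -/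
def yTilde (p : ℕ) : FreeProP p := FreeProP.of p (FreeGroup.of 1)

/-- The wreath product of a cyclic group of order `p` (the bottom group) with a cyclic group of
order `p ^ k` (the top group). -/
abbrev W (p k : ℕ) : Type :=
  RegularWreathProduct (Multiplicative (ZMod p)) (Multiplicative (ZMod (p ^ k)))

/-- The generator of the top group of the wreath product. -/
def xDot (p k : ℕ) : W p k := ⟨1, Multiplicative.ofAdd 1⟩

/-- The generator of (the copy at the identity coordinate of) the bottom group, an element of
the base group. -/
def yDot (p k : ℕ) : W p k := ⟨Pi.mulSingle 1 (Multiplicative.ofAdd 1), 1⟩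

/-- The base group of the wreath product. -/
def baseGroup (p k : ℕ) : Subgroup (W p k) :=
  (RegularWreathProduct.rightHom : W p k →* Multiplicative (ZMod (p ^ k))).ker

/-- The homomorphism from the abstract free group sending the two free generators to `xDot` and
`yDot`. -/
def discreteEta (p k : ℕ) : FreeGroup (Fin 2) →* W p k :=
  FreeGroup.lift ![xDot p k, yDot p k]

theorem discreteEta_ker_index (p k : ℕ) [Fact p.Prime] :
    ∃ n : ℕ, (discreteEta p k).ker.index = p ^ n := by
  have hp : p.Prime := Fact.out
  have : NeZero (p ^ k) := ⟨pow_ne_zero _ hp.ne_zero⟩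
  have : Finite (Multiplicative (ZMod (p ^ k))) := inferInstanceAs (Finite (ZMod (p ^ k)))
  have hc : Nat.card (W p k) = p ^ (p ^ k + k) := by
    rw [RegularWreathProduct.card]
    have h1 : Nat.card (Multiplicative (ZMod p)) = p := Nat.card_zmod p
    have h2 : Nat.card (Multiplicative (ZMod (p ^ k))) = p ^ k := Nat.card_zmod (p ^ k)
    rw [h1, h2, pow_add]
  have hd : (discreteEta p k).ker.index ∣ p ^ (p ^ k + k) := by
    rw [Subgroup.index_ker, ← hc]
    exact Subgroup.card_subgroup_dvd_card _
  obtain ⟨n, -, hn⟩ := (Nat.dvd_prime_pow hp).1 hd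
  exact ⟨n, hn⟩

/-- The kernel of `discreteEta`, as a normal subgroup of `p`-power index. -/
def discreteEtaKer (p k : ℕ) [Fact p.Prime] : PIndexNormal p :=
  ⟨(discreteEta p k).ker, inferInstance, discreteEta_ker_index p k⟩

/-- The continuous homomorphism from the free pro-`p` group to the wreath product induced by
`xTilde ↦ xDot` and `yTilde ↦ yDot`. -/
def eta (p k : ℕ) [Fact p.Prime] : FreeProP p →* W p k where
  toFun f := QuotientGroup.kerLift (discreteEta p k) (f.1 (discreteEtaKer p k))
  map_one' := map_one (QuotientGroup.kerLift (discreteEta p k))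
  map_mul' _ _ := map_mul (QuotientGroup.kerLift (discreteEta p k)) _ _

theorem eta_xTilde (p k : ℕ) [Fact p.Prime] : eta p k (xTilde p) = xDot p k := by
  change QuotientGroup.kerLift (discreteEta p k) (QuotientGroup.mk (FreeGroup.of 0)) = _
  rw [QuotientGroup.kerLift_mk]
  simp [discreteEta]

theorem eta_yTilde (p k : ℕ) [Fact p.Prime] : eta p k (yTilde p) = yDot p k := by
  change QuotientGroup.kerLift (discreteEta p k) (QuotientGroup.mk (FreeGroup.of 1)) = _
  rw [QuotientGroup.kerLift_mk]
  simp [discreteEta]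

theorem isOpen_ker_eta (p k : ℕ) [Fact p.Prime] : IsOpen ((eta p k).ker : Set (FreeProP p)) := by
  have hc : Continuous fun f : FreeProP p => f.1 (discreteEtaKer p k) :=
    (continuous_apply _).comp continuous_subtype_val
  exact (isOpen_discrete
    {q : PQuotient (discreteEtaKer p k) | QuotientGroup.kerLift (discreteEta p k) q = 1}).preimage hc

/-- The subgroup `P ^ p` generated by the `p`-th powers of the elements of the subgroup `P`. -/
def powSubgroup {G : Type*} [Group G] (p : ℕ) (P : Subgroup G) : Subgroup G :=
  Subgroup.closure {g | ∃ h ∈ P, h ^ p = g}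

/-- The kernel of `eta`. -/
def R (p k : ℕ) [Fact p.Prime] : Subgroup (FreeProP p) := (eta p k).ker

/-- The preimage of the base group under `eta`. -/
def Y (p k : ℕ) [Fact p.Prime] : Subgroup (FreeProP p) := (baseGroup p k).comap (eta p k)

/-- The closed normal subgroup `[R, Y] Y ^ p ⟨xTilde ^ (p ^ k)⟩^F` of the free pro-`p` group `F`.
The product of these normal subgroups is their join; as usual for profinite groups, it is
understood as a closed subgroup. -/
def N (p k : ℕ) [Fact p.Prime] : Subgroup (FreeProP p) :=
  (⁅R p k, Y p k⁆ ⊔ powSubgroup p (Y p k) ⊔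
    Subgroup.normalClosure {xTilde p ^ p ^ k}).topologicalClosure

theorem powSubgroup_normal {G : Type*} [Group G] (p : ℕ) (P : Subgroup G) [hP : P.Normal] :
    (powSubgroup p P).Normal := by
  have h : Subgroup.normalClosure {g | ∃ h ∈ P, h ^ p = g} = powSubgroup p P := by
    refine le_antisymm ?_ Subgroup.closure_le_normalClosure
    refine (Subgroup.closure_le _).2 fun g hg => ?_
    obtain ⟨a, ⟨h, hh, rfl⟩, hc⟩ := Group.mem_conjugatesOfSet_iff.1 hg
    obtain ⟨c, rfl⟩ := isConj_iff.1 hc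
    exact Subgroup.subset_closure ⟨c * h * c⁻¹, hP.conj_mem _ hh c, conj_pow⟩
  rw [← h]
  infer_instance

instance (p k : ℕ) [Fact p.Prime] : (N p k).Normal := by
  have : (R p k).Normal := inferInstanceAs (eta p k).ker.Normal
  have : (baseGroup p k).Normal := MonoidHom.normal_ker _
  have : (Y p k).Normal := inferInstanceAs ((baseGroup p k).comap (eta p k)).Normal
  have := powSubgroup_normal p (Y p k)
  exact Subgroup.is_normal_topologicalClosure _

/-- The quotient `G_k = F / N_k` of the free pro-`p` group. -/
abbrev G (p k : ℕ) [Fact p.Prime] : Type := FreeProP p ⧸ N p k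

/-- The image `x_k` of `xTilde` in `G_k`. -/
def x (p k : ℕ) [Fact p.Prime] : G p k := QuotientGroup.mk (xTilde p)

/-- The lower `p`-series `P_1 = G`, `P_i = P_{i-1} ^ p [P_{i-1}, G]` for `i ≥ 2`. The indexing
starts at `1`; the value at `0` is a dummy. -/
def lowerPSeries (p : ℕ) (G : Type*) [Group G] : ℕ → Subgroup G
  | 0 => ⊤
  | 1 => ⊤
  | i + 2 => powSubgroup p (lowerPSeries p G (i + 1)) ⊔ ⁅lowerPSeries p G (i + 1), ⊤⁆

end ProPWreath

/-! Put q = p^k. In G_k the image H of Y_k is generated by the q conjugates of y under powers of x,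
has exponent p, and is central modulo its centre, since the image of R_k is central in H and H
modulo that image is the abelian base group. For p odd such a group is described by a vector in
𝔽_p^q and an alternating q × q matrix, with product (v, m)(w, m') = (v + w, m + m' + v ∧ w). Adding
the cyclic shift of coordinates gives the concrete finite p-group `HeisenbergShift`. The defining
relators of G_k die there (`relators_le_ker`), and conversely the coordinates determine each element
(`injective_of_relations`). A density argument carries this to the free pro-p group
(`N_eq_ker_theta`), so G_k embeds into the model.

The nilpotency class is then linear algebra. With T the shift and Δ = T - 1, Δ^q = 0 in
characteristic p. On matrices the shift acts on rows and columns simultaneously, and each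
commutation raises the total order of divisibility by the row and column differences. At order 2q -
2 only matrices that do not depend on the row remain; those occurring in G_k have zero diagonal,
hence vanish, so γ_{2q} = 1 (`lowerCentralSeries_eq_bot`). The commutator of the iterated
commutators of x with y of vector parts Δ^(q-2) δ₀ and Δ^(q-1) δ₀ has a matrix entry 2 ≠ 0, so
γ_{2q-1} ≠ 1 (`lowerCentralSeries_ne_bot`).

Finally y^p = 1 and γ_2 has exponent p, so only x contributes p-th powers. As [x^(p^j), G] ≤
γ_{j+2}, an induction gives the formula for P_i (`lowerPSeries_eq_sup`), and the length follows from
the class. -/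

open scoped commutatorElement

namespace ProPWreath

/-! ### The model group: cyclic shifts acting on a Heisenberg group -/

/-- The triples consisting of a shift `s ∈ ℤ/n`, a vector and a matrix over `𝔽_p` indexed by
`ℤ/n`: the semidirect product of `ℤ/n` with a Heisenberg group of class two on `n` generators. -/
@[ext]
structure HeisenbergShift (p n : ℕ) where
  shift : ZMod n
  vec : ZMod n → ZMod p
  mat : ZMod n → ZMod n → ZMod p

namespace HeisenbergShift

variable {p n : ℕ}

instance : Mul (HeisenbergShift p n) where
  mul a b := ⟨a.shift + b.shift, fun i => a.vec i + b.vec (i - a.shift),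
    fun i j => a.mat i j + b.mat (i - a.shift) (j - a.shift) +
      (a.vec i * b.vec (j - a.shift) - a.vec j * b.vec (i - a.shift))⟩

instance : One (HeisenbergShift p n) where
  one := ⟨0, fun _ => 0, fun _ _ => 0⟩

instance : Inv (HeisenbergShift p n) where
  inv a := ⟨-a.shift, fun i => -a.vec (i + a.shift), fun i j => -a.mat (i + a.shift) (j + a.shift)⟩

@[simp] theorem shift_mul (a b : HeisenbergShift p n) :
    (a * b).shift = a.shift + b.shift := rfl

@[simp] theorem vec_mul (a b : HeisenbergShift p n) (i : ZMod n) :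
    (a * b).vec i = a.vec i + b.vec (i - a.shift) := rfl

@[simp] theorem mat_mul (a b : HeisenbergShift p n) (i j : ZMod n) :
    (a * b).mat i j = a.mat i j + b.mat (i - a.shift) (j - a.shift) +
      (a.vec i * b.vec (j - a.shift) - a.vec j * b.vec (i - a.shift)) := rfl

@[simp] theorem shift_one : (1 : HeisenbergShift p n).shift = 0 := rfl

@[simp] theorem vec_one (i : ZMod n) : (1 : HeisenbergShift p n).vec i = 0 := rfl

@[simp] theorem mat_one (i j : ZMod n) : (1 : HeisenbergShift p n).mat i j = 0 := rfl

@[simp] theorem shift_inv (a : HeisenbergShift p n) : a⁻¹.shift = -a.shift := rfl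

@[simp] theorem vec_inv (a : HeisenbergShift p n) (i : ZMod n) :
    a⁻¹.vec i = -a.vec (i + a.shift) := rfl

@[simp] theorem mat_inv (a : HeisenbergShift p n) (i j : ZMod n) :
    a⁻¹.mat i j = -a.mat (i + a.shift) (j + a.shift) := rfl

theorem ext' {a b : HeisenbergShift p n} (hs : a.shift = b.shift) (hv : ∀ i, a.vec i = b.vec i)
    (hm : ∀ i j, a.mat i j = b.mat i j) : a = b :=
  HeisenbergShift.ext hs (funext hv) (funext fun i => funext (hm i))

instance : Group (HeisenbergShift p n) where
  mul_assoc a b c := by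
    refine ext' (by simp [add_assoc]) (fun i => ?_) (fun i j => ?_)
    · simp only [vec_mul, shift_mul, sub_add_eq_sub_sub]; ring
    · simp only [mat_mul, vec_mul, shift_mul, sub_add_eq_sub_sub]; ring
  one_mul a := by refine ext' ?_ (fun i => ?_) (fun i j => ?_) <;> simp
  mul_one a := by refine ext' ?_ (fun i => ?_) (fun i j => ?_) <;> simp
  inv_mul_cancel a := by
    refine ext' ?_ (fun i => ?_) (fun i j => ?_)
    · simp
    · simp
    · simp only [mat_mul, vec_inv, mat_inv, shift_inv, sub_neg_eq_add, mat_one]; ring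

/-- The equivalence forgetting the group structure. -/
def equivProd (p n : ℕ) : HeisenbergShift p n ≃
    ZMod n × (ZMod n → ZMod p) × (ZMod n → ZMod n → ZMod p) where
  toFun a := (a.shift, a.vec, a.mat)
  invFun a := ⟨a.1, a.2.1, a.2.2⟩
  left_inv _ := rfl
  right_inv _ := rfl

instance [NeZero p] [NeZero n] : Finite (HeisenbergShift p n) :=
  .of_equiv _ (equivProd p n).symm

theorem exists_card_eq_pow (p k : ℕ) [Fact p.Prime] :
    ∃ m : ℕ, Nat.card (HeisenbergShift p (p ^ k)) = p ^ m := by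
  have : NeZero (p ^ k) := ⟨pow_ne_zero _ (Fact.out : p.Prime).ne_zero⟩
  refine ⟨k + (p ^ k + p ^ k * p ^ k), ?_⟩
  rw [Nat.card_congr (equivProd p (p ^ k))]
  simp only [Nat.card_prod, Nat.card_fun, Nat.card_zmod]
  ring

/-- The shift component as a homomorphism. -/
def shiftHom (p n : ℕ) : HeisenbergShift p n →* Multiplicative (ZMod n) where
  toFun a := Multiplicative.ofAdd a.shift
  map_one' := rfl
  map_mul' _ _ := rfl

/-- The generator of the group of shifts. -/
def gen₀ (p n : ℕ) : HeisenbergShift p n := ⟨1, fun _ => 0, fun _ _ => 0⟩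

/-- The basis vector at `0`. -/
def gen₁ (p n : ℕ) : HeisenbergShift p n := ⟨0, Pi.single 0 1, fun _ _ => 0⟩

/-- The projection to the wreath product forgetting the matrix. -/
def toW (p k : ℕ) : HeisenbergShift p (p ^ k) →* W p k where
  toFun a := ⟨fun i => Multiplicative.ofAdd (a.vec i.toAdd), Multiplicative.ofAdd a.shift⟩
  map_one' := rfl
  map_mul' a b := by
    ext i
    · change a.vec i.toAdd + b.vec (i.toAdd - a.shift) =
        a.vec i.toAdd + b.vec (-a.shift + i.toAdd)
      rw [neg_add_eq_sub]
    · rfl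

theorem toW_gen₀ (p k : ℕ) : toW p k (gen₀ p _) = xDot p k := rfl

theorem toW_gen₁ (p k : ℕ) : toW p k (gen₁ p _) = yDot p k := by
  refine RegularWreathProduct.ext (funext fun i => ?_) rfl
  by_cases h : i = 1
  · subst h; simp [toW, gen₁, yDot]
  · have h' : i.toAdd ≠ 0 := h
    simp [toW, gen₁, yDot, h, h']

theorem toW_eq_one_iff {k : ℕ} {a : HeisenbergShift p (p ^ k)} :
    toW p k a = 1 ↔ a.shift = 0 ∧ a.vec = 0 := by
  constructor
  · intro h
    exact ⟨congrArg RegularWreathProduct.right h,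
      funext fun i => congrFun (congrArg RegularWreathProduct.left h) (Multiplicative.ofAdd i)⟩
  · rintro ⟨h₁, h₂⟩
    ext i
    · change a.vec _ = 0
      simp [h₂]
    · exact h₁

theorem toW_mem_baseGroup_iff {k : ℕ} {a : HeisenbergShift p (p ^ k)} :
    toW p k a ∈ baseGroup p k ↔ a.shift = 0 := Iff.rfl

theorem gen₀_pow (m : ℕ) : gen₀ p n ^ m = ⟨m, fun _ => 0, fun _ _ => 0⟩ := by
  induction m with
  | zero => rw [pow_zero]; refine ext' ?_ (fun i => ?_) (fun i j => ?_) <;> simp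
  | succ m ih =>
    rw [pow_succ, ih]
    refine ext' ?_ (fun i => ?_) (fun i j => ?_) <;> simp [gen₀]

theorem gen₀_pow_self : gen₀ p n ^ n = 1 := by
  rw [gen₀_pow]
  refine ext' ?_ (fun i => ?_) (fun i j => ?_) <;> simp

/-- The cocycle v ∧ w vanishes on proportional vectors, so powers of unshifted elements are
coordinatewise multiples. This gives exponent p. -/
theorem pow_eq_of_shift_eq_zero {a : HeisenbergShift p n} (ha : a.shift = 0) (m : ℕ) :
    a ^ m = ⟨0, fun i => m * a.vec i, fun i j => m * a.mat i j⟩ := by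
  induction m with
  | zero => rw [pow_zero]; refine ext' ?_ (fun i => ?_) (fun i j => ?_) <;> simp
  | succ m ih =>
    rw [pow_succ, ih]
    refine ext' ?_ (fun i => ?_) (fun i j => ?_)
    · simp [ha]
    · simp; ring
    · simp; ring

theorem pow_char_eq_one_of_shift_eq_zero {a : HeisenbergShift p n} (ha : a.shift = 0) :
    a ^ p = 1 := by
  rw [pow_eq_of_shift_eq_zero ha]
  refine ext' ?_ (fun i => ?_) (fun i j => ?_) <;> simp

theorem commute_of_vec_eq_zero {a b : HeisenbergShift p n} (ha : a.shift = 0) (hv : a.vec = 0)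
    (hb : b.shift = 0) : Commute a b := by
  refine ext' ?_ (fun i => ?_) (fun i j => ?_)
  · simp [ha, hb]
  · simp [ha, hb, hv]
  · simp [ha, hb, hv, add_comm]

end HeisenbergShift

/-! ### Relators of G_k and faithfulness of the model -/

/-- The obstruction subgroup `[R, Y] Y ^ p ⟨x ^ (p ^ k)⟩` lies in the kernel of every lift of a
homomorphism to the wreath product to the Heisenberg group. -/
theorem relators_le_ker {Φ : Type*} [Group Φ] {p k : ℕ} (η : Φ →* W p k)
    (θ : Φ →* HeisenbergShift p (p ^ k)) (h : ∀ g, HeisenbergShift.toW p k (θ g) = η g) (x : Φ)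
    (hx : θ x = HeisenbergShift.gen₀ p (p ^ k)) :
    ⁅η.ker, (baseGroup p k).comap η⁆ ⊔ powSubgroup p ((baseGroup p k).comap η) ⊔
      Subgroup.normalClosure {x ^ p ^ k} ≤ θ.ker := by
  have hY : ∀ g ∈ (baseGroup p k).comap η, (θ g).shift = 0 := fun g hg => by
    rw [Subgroup.mem_comap, ← h] at hg
    exact HeisenbergShift.toW_mem_baseGroup_iff.1 hg
  refine sup_le (sup_le ?_ ?_) ?_
  · refine Subgroup.commutator_le.2 fun r hr y hy => ?_
    rw [MonoidHom.mem_ker, ← h] at hr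
    have hr' := HeisenbergShift.toW_eq_one_iff.1 hr
    rw [MonoidHom.mem_ker, map_commutatorElement, commutatorElement_eq_one_iff_commute]
    exact HeisenbergShift.commute_of_vec_eq_zero hr'.1 hr'.2 (hY y hy)
  · refine (Subgroup.closure_le _).2 ?_
    rintro _ ⟨y, hy, rfl⟩
    rw [SetLike.mem_coe, MonoidHom.mem_ker, map_pow]
    exact HeisenbergShift.pow_char_eq_one_of_shift_eq_zero (hY y hy)
  · refine Subgroup.normalClosure_le_normal ?_
    rw [Set.singleton_subset_iff, SetLike.mem_coe, MonoidHom.mem_ker, map_pow, hx,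
      HeisenbergShift.gen₀_pow_self]

/-- A group of exponent `p` and class two is determined by its linear and alternating
coordinates with respect to a generating family whose linear coordinates are the unit vectors. -/
theorem eq_one_of_vec_eq_zero_of_mat_eq_zero {H ι : Type*} [Group H] [Fintype ι] [DecidableEq ι]
    {p : ℕ} [Fact p.Prime] (hp : p ≠ 2) (y : ι → H)
    (hy : Subgroup.closure (Set.range y) = ⊤) (hpow : ∀ h : H, h ^ p = 1)
    (vec : H → ι → ZMod p) (mat : H → ι → ι → ZMod p)
    (hvec : ∀ a b, vec (a * b) = vec a + vec b)
    (hmat : ∀ a b i j, mat (a * b) i j =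
      mat a i j + mat b i j + (vec a i * vec b j - vec a j * vec b i))
    (hvy : ∀ i, vec (y i) = Pi.single i 1) (hc : ∀ g, vec g = 0 → g ∈ Subgroup.center H)
    {g : H} (hgv : vec g = 0) (hgm : mat g = 0) : g = 1 := by
  have h4 : (4 : ZMod p) ≠ 0 := by
    have : ((2 : ℕ) : ZMod p) ≠ 0 := by
      rw [Ne, ZMod.natCast_eq_zero_iff]
      exact fun h => hp ((Nat.prime_dvd_prime_iff_eq Fact.out Nat.prime_two).1 h)
    have h22 : (4 : ZMod p) = ((2 : ℕ) : ZMod p) * ((2 : ℕ) : ZMod p) := by push_cast; norm_num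
    rw [h22]
    exact mul_ne_zero this this
  have hv1 : vec 1 = 0 := by simpa using hvec 1 1
  have hm1 : ∀ i j, mat 1 i j = 0 := fun i j => by simpa [hv1] using hmat 1 1 i j
  have hvinv : ∀ a, vec a⁻¹ = -vec a := fun a => by
    have := hvec a⁻¹ a
    rw [inv_mul_cancel, hv1] at this
    exact eq_neg_of_add_eq_zero_left this.symm
  have hvcomm : ∀ a b, vec ⁅a, b⁆ = 0 := fun a b => by
    rw [commutatorElement_def, hvec, hvec, hvec, hvinv, hvinv]; abel
  have hmcomm : ∀ a b i j, mat ⁅a, b⁆ i j = 2 * (vec a i * vec b j - vec a j * vec b i) := by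
    intro a b i j
    -- This product form avoids the matrix coordinates of inverses; comparing the two sides isolates
    -- the commutator, whose vector part is zero.
    have h1 : ⁅a, b⁆ * (b * a) = a * b := by rw [commutatorElement_def]; group
    have h2 := congrArg (fun z => mat z i j) h1
    simp only [hmat, hvcomm, Pi.zero_apply] at h2
    linear_combination h2
  -- the linear coordinates determine the class in the abelianization
  have hab : g ∈ commutator H := by
    let _ : Module (ZMod p) (Additive (Abelianization H)) := AddCommGroup.zmodModule (by
      intro z
      induction z with | ofMul z =>
      obtain ⟨h, rfl⟩ : ∃ h, Abelianization.of h = z := QuotientGroup.mk_surjective z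
      rw [← ofMul_pow, ← map_pow, hpow, map_one, ofMul_one])
    let ψ : (ι → ZMod p) → Additive (Abelianization H) :=
      fun v => ∑ i, v i • Additive.ofMul (Abelianization.of (y i))
    have key : ∀ h : H, ψ (vec h) = Additive.ofMul (Abelianization.of h) := by
      intro h
      have hh : h ∈ Subgroup.closure (Set.range y) := hy ▸ Subgroup.mem_top h
      induction hh using Subgroup.closure_induction with
      | mem _ h =>
        obtain ⟨i, rfl⟩ := h
        simp only [ψ, hvy]
        rw [Finset.sum_eq_single i]
        · simp
        · intro j _ hj; simp [hj]
        · simp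
      | one => simp [ψ, hv1]
      | mul a b _ _ iha ihb =>
        rw [map_mul, ofMul_mul, ← iha, ← ihb]
        simp [ψ, hvec, add_smul, Finset.sum_add_distrib]
      | inv a _ iha =>
        rw [map_inv, ofMul_inv, ← iha]
        simp [ψ, hvinv, neg_smul]
    have h0 : Additive.ofMul (Abelianization.of g) = 0 := by rw [← key g, hgv]; simp [ψ]
    rw [← Abelianization.ker_of]
    exact h0
  have hcen : ∀ a b : H, ⁅a, b⁆ ∈ Subgroup.center H := fun a b => hc _ (hvcomm a b)
  let _ : CommGroup (Subgroup.center H) :=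
    { (inferInstance : Group (Subgroup.center H)) with
      mul_comm := fun a b => Subtype.ext (Subgroup.mem_center_iff.1 b.2 a) }
  let _ : Module (ZMod p) (Additive (Subgroup.center H)) := AddCommGroup.zmodModule (by
    intro z
    induction z with | ofMul z =>
    rw [← ofMul_pow]
    exact congrArg Additive.ofMul (Subtype.ext (hpow z)))
  -- The commutator pairing into the centre is biadditive because commutators are central.
  let κ : H → H → Additive (Subgroup.center H) := fun a b => Additive.ofMul ⟨⁅a, b⁆, hcen a b⟩
  have κ_mul_left : ∀ a b c, κ (a * b) c = κ a c + κ b c := by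
    intro a b c
    refine congrArg Additive.ofMul (Subtype.ext ?_)
    have h2 := Subgroup.mem_center_iff.1 (hcen b c) a
    change ⁅a * b, c⁆ = ⁅a, c⁆ * ⁅b, c⁆
    calc ⁅a * b, c⁆ = (a * ⁅b, c⁆) * (c * a⁻¹ * c⁻¹) := by
          simp only [commutatorElement_def]; group
      _ = ⁅b, c⁆ * ⁅a, c⁆ := by rw [h2]; simp only [commutatorElement_def]; group
      _ = ⁅a, c⁆ * ⁅b, c⁆ := (Subgroup.mem_center_iff.1 (hcen b c) _).symm
  have κ_symm : ∀ a b, κ a b = -κ b a := by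
    intro a b
    refine congrArg Additive.ofMul (Subtype.ext ?_)
    exact (commutatorElement_inv b a).symm
  have κ_mul_right : ∀ a b c, κ a (b * c) = κ a b + κ a c := by
    intro a b c
    rw [κ_symm, κ_mul_left, κ_symm a b, κ_symm a c, neg_add]
  have κ_one_left : ∀ c, κ 1 c = 0 := fun c => by simpa using κ_mul_left 1 1 c
  have κ_one_right : ∀ c, κ c 1 = 0 := fun c => by simpa using κ_mul_right c 1 1
  have κ_inv_left : ∀ a c, κ a⁻¹ c = -κ a c := fun a c => by
    have := κ_mul_left a⁻¹ a c
    rw [inv_mul_cancel, κ_one_left] at this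
    exact eq_neg_of_add_eq_zero_left this.symm
  have κ_inv_right : ∀ a c, κ a c⁻¹ = -κ a c := fun a c => by
    rw [κ_symm, κ_inv_left, κ_symm a c]
  -- A left inverse to the matrix coordinate on commutators. The matrix of the commutator of `y i`
  -- and `y j` has entries 2 at (i, j) and -2 at (j, i) for i ≠ j, and the double sum sees both, so
  -- the total 2 + 2 must be divided by 4; this uses that p is odd.
  let Ψ : (ι → ι → ZMod p) → Additive (Subgroup.center H) :=
    fun m => ∑ i, ∑ j, (4⁻¹ * m i j) • κ (y i) (y j)
  let B : H → H → ι → ι → ZMod p := fun a b i j => 2 * (vec a i * vec b j - vec a j * vec b i)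
  have Ψ_add : ∀ m m', Ψ (m + m') = Ψ m + Ψ m' := fun m m' => by
    simp [Ψ, mul_add, add_smul, Finset.sum_add_distrib]
  have Ψ_zero : Ψ 0 = 0 := by simp [Ψ]
  have Ψ_neg : ∀ m, Ψ (-m) = -Ψ m := fun m => by simp [Ψ]
  have keygen : ∀ i j, Ψ (B (y i) (y j)) = κ (y i) (y j) := by
    intro i j
    have h1 : ∀ (i j : ι), Ψ (fun a b => (2 : ZMod p) *
        ((Pi.single i 1 : ι → ZMod p) a * (Pi.single j 1 : ι → ZMod p) b)) =
        ((4⁻¹ * 2 : ZMod p)) • κ (y i) (y j) := by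
      intro i j
      simp only [Ψ]
      rw [Finset.sum_eq_single i, Finset.sum_eq_single j]
      · simp
      · intro b _ hb; simp [hb]
      · simp
      · intro b _ hb; simp [hb]
      · simp
    have h2 : B (y i) (y j) = (fun a b => (2 : ZMod p) *
        ((Pi.single i 1 : ι → ZMod p) a * (Pi.single j 1 : ι → ZMod p) b)) +
        -(fun a b => (2 : ZMod p) *
        ((Pi.single j 1 : ι → ZMod p) a * (Pi.single i 1 : ι → ZMod p) b)) := by
      funext a b
      simp only [B, hvy, Pi.add_apply, Pi.neg_apply]
      ring
    rw [h2, Ψ_add, Ψ_neg, h1, h1, κ_symm (y j), smul_neg, neg_neg, ← add_smul]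
    have : (4⁻¹ * 2 + 4⁻¹ * 2 : ZMod p) = 1 := by
      rw [← mul_add, show (2 + 2 : ZMod p) = 4 by norm_num, inv_mul_cancel₀ h4]
    rw [this, one_smul]
  have top : ∀ h : H, h ∈ Subgroup.closure (Set.range y) := fun h => hy ▸ Subgroup.mem_top h
  have keyleft : ∀ (a : H) (j : ι), Ψ (B a (y j)) = κ a (y j) := by
    intro a j
    induction top a using Subgroup.closure_induction with
    | mem _ h => obtain ⟨i, rfl⟩ := h; exact keygen i j
    | one =>
      rw [κ_one_left, ← Ψ_zero]; congr 1; funext a b; simp [B, hv1]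
    | mul a b _ _ iha ihb =>
      rw [κ_mul_left, ← iha, ← ihb, ← Ψ_add]; congr 1; funext a b; simp [B, hvec]; ring
    | inv a _ iha =>
      rw [κ_inv_left, ← iha, ← Ψ_neg]; congr 1; funext a b; simp [B, hvinv]; ring
  have keyall : ∀ a b : H, Ψ (B a b) = κ a b := by
    intro a b
    induction top b using Subgroup.closure_induction with
    | mem _ h => obtain ⟨i, rfl⟩ := h; exact keyleft a i
    | one =>
      rw [κ_one_right, ← Ψ_zero]; congr 1; funext a b; simp [B, hv1]
    | mul b c _ _ ihb ihc =>
      rw [κ_mul_right, ← ihb, ← ihc, ← Ψ_add]; congr 1; funext a b; simp [B, hvec]; ring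
    | inv b _ ihb =>
      rw [κ_inv_right, ← ihb, ← Ψ_neg]; congr 1; funext a b; simp [B, hvinv]; ring
  -- On the derived subgroup all vectors vanish, so the matrix coordinate is additive there, and the
  -- identity known for single commutators extends to their products. The vanishing hypotheses on g
  -- are dropped to let the induction run over all of the derived subgroup.
  have hfin : vec g = 0 ∧ ∃ hz : g ∈ Subgroup.center H, Ψ (mat g) = Additive.ofMul ⟨g, hz⟩ := by
    rw [commutator_def, Subgroup.commutator_def] at hab
    clear hgv hgm
    induction hab using Subgroup.closure_induction with
    | mem _ h =>
      obtain ⟨a, -, b, -, rfl⟩ := h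
      refine ⟨hvcomm a b, hcen a b, ?_⟩
      rw [show mat ⁅a, b⁆ = B a b from funext fun i => funext fun j => hmcomm a b i j]
      exact keyall a b
    | one =>
      refine ⟨hv1, one_mem _, ?_⟩
      rw [show mat 1 = 0 from funext fun i => funext fun j => hm1 i j, Ψ_zero]
      rfl
    | mul a b _ _ iha ihb =>
      obtain ⟨ha, hza, iha⟩ := iha
      obtain ⟨hb, hzb, ihb⟩ := ihb
      refine ⟨by rw [hvec, ha, hb, add_zero], mul_mem hza hzb, ?_⟩
      rw [show mat (a * b) = mat a + mat b from funext fun i => funext fun j => by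
        simp [hmat, ha], Ψ_add, iha, ihb]
      rfl
    | inv a _ iha =>
      obtain ⟨ha, hza, iha⟩ := iha
      refine ⟨by rw [hvinv, ha, neg_zero], inv_mem hza, ?_⟩
      have : mat a⁻¹ = -mat a := funext fun i => funext fun j => by
        have := hmat a⁻¹ a i j
        rw [inv_mul_cancel, hm1, ha] at this
        simp at this
        exact eq_neg_of_add_eq_zero_left this.symm
      rw [this, Ψ_neg, iha]
      rfl
  obtain ⟨-, hz, hg⟩ := hfin
  rw [hgm, Ψ_zero] at hg
  exact congrArg Subtype.val (Additive.ofMul.injective hg).symm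

theorem zpow_eq_pow_val_of_pow_eq_one {G : Type*} [Group G] {n : ℕ} [NeZero n] {x : G}
    (hx : x ^ n = 1) (a : ℤ) : x ^ a = x ^ (a : ZMod n).val := by
  rw [← zpow_natCast, ZMod.val_intCast]
  conv_lhs => rw [← Int.emod_add_mul_ediv a n, zpow_add, zpow_mul, zpow_natCast x n, hx, one_zpow,
    mul_one]

/-- In a group generated by `x` and `y`, every element is a product of conjugates of `y` by powers
of `x` and a power of `x`. -/
theorem exists_mul_zpow_of_closure_pair {G : Type*} [Group G] {n : ℕ} [NeZero n] {x y : G}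
    (hx : x ^ n = 1) (hG : Subgroup.closure {x, y} = ⊤) (g : G) :
    ∃ s ∈ Subgroup.closure (Set.range fun i : ZMod n => x ^ i.val * y * (x ^ i.val)⁻¹),
      ∃ a : ℤ, g = s * x ^ a := by
  -- Right multiplication by y is absorbed through s x^a y = s (x^a y x^(-a)) x^a.
  have hmem : ∀ a : ℤ, x ^ a * y * (x ^ a)⁻¹ ∈
      Subgroup.closure (Set.range fun i : ZMod n => x ^ i.val * y * (x ^ i.val)⁻¹) := fun a => by
    rw [zpow_eq_pow_val_of_pow_eq_one hx a]
    exact Subgroup.subset_closure ⟨(a : ZMod n), rfl⟩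
  have hg : g ∈ Subgroup.closure {x, y} := hG ▸ Subgroup.mem_top g
  induction hg using Subgroup.closure_induction_right with
  | one => exact ⟨1, one_mem _, 0, by simp⟩
  | mul_right g _ z hz ih =>
    obtain ⟨s, hs, a, rfl⟩ := ih
    rcases hz with rfl | rfl
    · exact ⟨s, hs, a + 1, by rw [zpow_add, zpow_one, mul_assoc]⟩
    · exact ⟨_, mul_mem hs (hmem a), a, by group⟩
  | mul_inv_cancel g _ z hz ih =>
    obtain ⟨s, hs, a, rfl⟩ := ih
    rcases hz with rfl | rfl
    · exact ⟨s, hs, a - 1, by rw [zpow_sub, zpow_one, mul_assoc]⟩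
    · exact ⟨_, mul_mem hs (inv_mem (hmem a)), a, by group⟩

open HeisenbergShift in
/-- A two-generator group with the relations of `HeisenbergShift` embeds into it. -/
theorem injective_of_relations {G : Type*} [Group G] {p n : ℕ} [Fact p.Prime] [NeZero n]
    (hp : p ≠ 2) {x y : G} (hG : Subgroup.closure {x, y} = ⊤) (θ : G →* HeisenbergShift p n)
    (hθx : θ x = gen₀ p n) (hθy : θ y = gen₁ p n) (hx : x ^ n = 1)
    (hpow : ∀ h, (θ h).shift = 0 → h ^ p = 1)
    (hcomm : ∀ r h, (θ r).shift = 0 → (θ r).vec = 0 → (θ h).shift = 0 → Commute r h) :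
    Function.Injective θ := by
  rw [injective_iff_map_eq_one]
  intro g hg
  let H : Subgroup G := ((shiftHom p n).comp θ).ker
  have hH : ∀ h : H, (θ h).shift = 0 := fun h => h.2
  have hyv : ∀ i : ZMod n, θ (x ^ i.val * y * (x ^ i.val)⁻¹) =
      gen₀ p n ^ i.val * gen₁ p n * (gen₀ p n ^ i.val)⁻¹ := fun i => by
    simp only [map_mul, map_inv, map_pow, hθx, hθy]
  let yy : ZMod n → H := fun i => ⟨x ^ i.val * y * (x ^ i.val)⁻¹, by
    change (θ (x ^ i.val * y * (x ^ i.val)⁻¹)).shift = 0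
    rw [hyv, gen₀_pow]
    simp [gen₁]⟩
  have hclosure : Subgroup.closure (Set.range yy) = ⊤ := by
    apply Subgroup.map_injective H.subtype_injective
    rw [MonoidHom.map_closure, ← Set.range_comp, ← MonoidHom.range_eq_map, Subgroup.range_subtype]
    refine le_antisymm ((Subgroup.closure_le _).2 ?_) fun h hh => ?_
    · rintro _ ⟨i, rfl⟩
      exact (yy i).2
    · obtain ⟨s, hs, a, rfl⟩ := exists_mul_zpow_of_closure_pair hx hG h
      have hsH : s ∈ H := by
        refine (Subgroup.closure_le H).2 ?_ hs
        rintro _ ⟨i, rfl⟩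
        exact (yy i).2
      -- The shift reads off the exponent of x modulo n, so an element of H has no x-part and is a
      -- product of conjugates of y and their inverses.
      have hxa : x ^ (a : ZMod n).val ∈ H := by
        rw [← zpow_eq_pow_val_of_pow_eq_one hx]
        exact (Subgroup.mul_mem_cancel_left _ hsH).1 hh
      have ha : (θ (x ^ (a : ZMod n).val)).shift = 0 := hxa
      rw [map_pow, hθx, gen₀_pow] at ha
      simp only [ZMod.natCast_val, ZMod.cast_id', id_eq] at ha
      rw [zpow_eq_pow_val_of_pow_eq_one hx, ha, ZMod.val_zero, pow_zero, mul_one]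
      exact hs
  have hgH : g ∈ H := by
    change (θ g).shift = 0
    rw [hg, shift_one]
  have := eq_one_of_vec_eq_zero_of_mat_eq_zero (H := H) hp yy hclosure
    (fun h => Subtype.ext (hpow h (hH h))) (fun h => (θ h).vec) (fun h => (θ h).mat)
    (fun a b => by
      funext i
      simp [hH])
    (fun a b i j => by simp [hH])
    (fun i => by
      funext j
      simp only [yy, hyv, gen₀_pow]
      simp [gen₁, Pi.single_apply, sub_eq_zero])
    (fun r hr => Subgroup.mem_center_iff.2 fun h =>
      Subtype.ext (hcomm r h (hH r) hr (hH h)).symm)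
    (g := ⟨g, hgH⟩)
    (by funext i; simp [hg]) (by funext i j; simp [hg])
  exact congrArg Subtype.val this

/-! ### From the abstract free group to its pro-p completion -/

open HeisenbergShift

/-- The homomorphism from the abstract free group sending the two free generators to `gen₀` and
`gen₁`. -/
def discreteTheta (p k : ℕ) : FreeGroup (Fin 2) →* HeisenbergShift p (p ^ k) :=
  FreeGroup.lift ![gen₀ p (p ^ k), gen₁ p (p ^ k)]

theorem toW_discreteTheta (p k : ℕ) (w : FreeGroup (Fin 2)) :
    toW p k (discreteTheta p k w) = discreteEta p k w := by
  have : (toW p k).comp (discreteTheta p k) = discreteEta p k := by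
    refine FreeGroup.ext_hom _ _ fun i => ?_
    fin_cases i
    · simp [discreteTheta, discreteEta, toW_gen₀]
    · simp [discreteTheta, discreteEta, toW_gen₁]
  exact DFunLike.congr_fun this w

theorem closure_freeGroup_generators :
    Subgroup.closure {FreeGroup.of (0 : Fin 2), FreeGroup.of 1} = ⊤ := by
  rw [← FreeGroup.closure_range_of]
  congr 1
  ext g
  simp [Fin.exists_fin_two, eq_comm]

/-- The quotient by the relators satisfies the hypotheses of `injective_of_relations`, so the
relators account for the whole kernel. -/
theorem ker_discreteTheta (p k : ℕ) [Fact p.Prime] (hp : p ≠ 2) :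
    ⁅(discreteEta p k).ker, (baseGroup p k).comap (discreteEta p k)⁆ ⊔
      powSubgroup p ((baseGroup p k).comap (discreteEta p k)) ⊔
      Subgroup.normalClosure {FreeGroup.of (0 : Fin 2) ^ p ^ k} = (discreteTheta p k).ker := by
  have hθ0 : discreteTheta p k (FreeGroup.of 0) = gen₀ p _ := by simp [discreteTheta]
  have hθ1 : discreteTheta p k (FreeGroup.of 1) = gen₁ p _ := by simp [discreteTheta]
  have hle := relators_le_ker (discreteEta p k) (discreteTheta p k) (toW_discreteTheta p k) _ hθ0
  refine le_antisymm hle ?_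
  have hB : (baseGroup p k).Normal := MonoidHom.normal_ker _
  have := powSubgroup_normal p ((baseGroup p k).comap (discreteEta p k))
  have : NeZero (p ^ k) := ⟨pow_ne_zero _ (Fact.out : p.Prime).ne_zero⟩
  generalize hN' : ⁅(discreteEta p k).ker, (baseGroup p k).comap (discreteEta p k)⁆ ⊔
      powSubgroup p ((baseGroup p k).comap (discreteEta p k)) ⊔
      Subgroup.normalClosure {FreeGroup.of (0 : Fin 2) ^ p ^ k} = N' at hle
  have hN : N'.Normal := hN' ▸ inferInstance
  let θ : FreeGroup (Fin 2) ⧸ N' →* HeisenbergShift p (p ^ k) :=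
    QuotientGroup.lift N' (discreteTheta p k) hle
  have hY : ∀ w, (discreteTheta p k w).shift = 0 →
      w ∈ (baseGroup p k).comap (discreteEta p k) := fun w hw => by
    rw [Subgroup.mem_comap, ← toW_discreteTheta]
    exact toW_mem_baseGroup_iff.2 hw
  have hinj : Function.Injective θ := by
    refine injective_of_relations (x := QuotientGroup.mk' N' (FreeGroup.of 0))
      (y := QuotientGroup.mk' N' (FreeGroup.of 1)) hp ?_ θ hθ0 hθ1 ?_ ?_ ?_
    · rw [← Set.image_pair, ← MonoidHom.map_closure, closure_freeGroup_generators,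
        ← MonoidHom.range_eq_map, MonoidHom.range_eq_top]
      exact QuotientGroup.mk'_surjective N'
    · rw [← map_pow]
      refine (QuotientGroup.eq_one_iff _).2 (hN' ▸ ?_)
      exact Subgroup.mem_sup_right (Subgroup.subset_normalClosure rfl)
    · intro h hh
      obtain ⟨w, rfl⟩ := QuotientGroup.mk'_surjective N' h
      rw [← map_pow]
      refine (QuotientGroup.eq_one_iff _).2 (hN' ▸ ?_)
      exact Subgroup.mem_sup_left (Subgroup.mem_sup_right
        (Subgroup.subset_closure ⟨w, hY w hh, rfl⟩))
    · intro r h hr₁ hr₂ hh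
      obtain ⟨u, rfl⟩ := QuotientGroup.mk'_surjective N' r
      obtain ⟨w, rfl⟩ := QuotientGroup.mk'_surjective N' h
      rw [← commutatorElement_eq_one_iff_commute, ← map_commutatorElement]
      refine (QuotientGroup.eq_one_iff _).2 (hN' ▸ ?_)
      refine Subgroup.mem_sup_left (Subgroup.mem_sup_left
        (Subgroup.commutator_mem_commutator ?_ (hY w hh)))
      rw [MonoidHom.mem_ker, ← toW_discreteTheta]
      exact toW_eq_one_iff.2 ⟨hr₁, hr₂⟩
  intro w hw
  have h1 : θ (QuotientGroup.mk' N' w) = θ 1 := by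
    rw [map_one]
    exact hw
  exact (QuotientGroup.eq_one_iff _).1 (hinj h1)

theorem discreteTheta_ker_index (p k : ℕ) [Fact p.Prime] :
    ∃ m : ℕ, (discreteTheta p k).ker.index = p ^ m := by
  obtain ⟨m, hm⟩ := exists_card_eq_pow p k
  have hd : (discreteTheta p k).ker.index ∣ p ^ m := by
    rw [Subgroup.index_ker, ← hm]
    exact Subgroup.card_subgroup_dvd_card _
  obtain ⟨n, -, hn⟩ := (Nat.dvd_prime_pow Fact.out).1 hd
  exact ⟨n, hn⟩

/-- The kernel of `discreteTheta`, as a normal subgroup of `p`-power index. -/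
def discreteThetaKer (p k : ℕ) [Fact p.Prime] : PIndexNormal p :=
  ⟨(discreteTheta p k).ker, inferInstance, discreteTheta_ker_index p k⟩

/-- The continuous extension of `discreteTheta` to the free pro-`p` group. -/
def theta (p k : ℕ) [Fact p.Prime] : FreeProP p →* HeisenbergShift p (p ^ k) where
  toFun f := QuotientGroup.kerLift (discreteTheta p k) (f.1 (discreteThetaKer p k))
  map_one' := map_one (QuotientGroup.kerLift (discreteTheta p k))
  map_mul' _ _ := map_mul (QuotientGroup.kerLift (discreteTheta p k)) _ _

theorem theta_of (p k : ℕ) [Fact p.Prime] (w : FreeGroup (Fin 2)) :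
    theta p k (FreeProP.of p w) = discreteTheta p k w := rfl

theorem PQuotient.mk_surjective {p : ℕ} (N : PIndexNormal p) :
    Function.Surjective (PQuotient.mk N) := QuotientGroup.mk'_surjective N.1

theorem ker_discreteTheta_le (p k : ℕ) :
    (discreteTheta p k).ker ≤ (discreteEta p k).ker := fun w hw => by
  rw [MonoidHom.mem_ker, ← toW_discreteTheta, MonoidHom.mem_ker.1 hw, map_one]

/-- Modulo the kernel of `theta`, every element of the free pro-`p` group comes from the abstract
free group. -/
theorem exists_theta_eq (p k : ℕ) [Fact p.Prime] (f : FreeProP p) :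
    ∃ w, theta p k f = discreteTheta p k w ∧ eta p k f = discreteEta p k w := by
  obtain ⟨w, hw⟩ := PQuotient.mk_surjective _ (f.1 (discreteThetaKer p k))
  refine ⟨w, ?_, ?_⟩
  · change QuotientGroup.kerLift (discreteTheta p k) (f.1 (discreteThetaKer p k)) = _
    rw [← hw]
    rfl
  · change QuotientGroup.kerLift (discreteEta p k) (f.1 (discreteEtaKer p k)) = _
    rw [← f.2 (discreteThetaKer p k) (discreteEtaKer p k) (ker_discreteTheta_le p k), ← hw]
    rfl

theorem toW_theta (p k : ℕ) [Fact p.Prime] (f : FreeProP p) :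
    toW p k (theta p k f) = eta p k f := by
  obtain ⟨w, h₁, h₂⟩ := exists_theta_eq p k f
  rw [h₁, h₂, toW_discreteTheta]

theorem isClosed_ker_theta (p k : ℕ) [Fact p.Prime] :
    IsClosed ((theta p k).ker : Set (FreeProP p)) := by
  have hc : Continuous fun f : FreeProP p => f.1 (discreteThetaKer p k) :=
    (continuous_apply _).comp continuous_subtype_val
  exact (isClosed_discrete {q : PQuotient (discreteThetaKer p k) |
    QuotientGroup.kerLift (discreteTheta p k) q = 1}).preimage hc

theorem exists_pIndexNormal_le {p : ℕ} [Fact p.Prime] (I : Finset (PIndexNormal p))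
    (N₀ : PIndexNormal p) : ∃ M : PIndexNormal p, M.1 ≤ N₀.1 ∧ ∀ N ∈ I, M.1 ≤ N.1 := by
  classical
  induction I using Finset.induction_on with
  | empty => exact ⟨N₀, le_rfl, by simp⟩
  | insert A I _ ih =>
    obtain ⟨M, hM₀, hM⟩ := ih
    obtain ⟨a, ha⟩ := A.2.2
    obtain ⟨b, hb⟩ := M.2.2
    have hd : (A.1 ⊓ M.1).index ∣ p ^ (b + a) := by
      rw [← Subgroup.relIndex_mul_index (inf_le_left : A.1 ⊓ M.1 ≤ A.1),
        Subgroup.inf_relIndex_left, ha, pow_add, ← hb]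
      exact mul_dvd_mul_right (Subgroup.relIndex_dvd_index_of_normal _ _) _
    obtain ⟨c, -, hc⟩ := (Nat.dvd_prime_pow Fact.out).1 hd
    refine ⟨⟨A.1 ⊓ M.1, inferInstance, c, hc⟩, inf_le_right.trans hM₀, fun N hN => ?_⟩
    rcases Finset.mem_insert.1 hN with rfl | hN
    · exact inf_le_left
    · exact inf_le_right.trans (hM N hN)

/-- A basic neighbourhood of f constrains finitely many finite quotients. A single M below these and
below the kernel of `discreteTheta` supplies a word w that agrees with f on all of them; since f is
killed by `theta`, w lies in the discrete kernel. -/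
theorem ker_theta_le_topologicalClosure (p k : ℕ) [Fact p.Prime] :
    (theta p k).ker ≤ ((discreteTheta p k).ker.map (FreeProP.of p)).topologicalClosure := by
  intro f hf
  change f ∈ closure _
  rw [mem_closure_iff]
  rintro U ⟨V, hV, rfl⟩ hfV
  obtain ⟨I, u, hu, huV⟩ := isOpen_pi_iff.1 hV f.1 hfV
  obtain ⟨M, hM₀, hM⟩ := exists_pIndexNormal_le I (discreteThetaKer p k)
  obtain ⟨w, hw⟩ := PQuotient.mk_surjective _ (f.1 M)
  have hwN : ∀ N : PIndexNormal p, M.1 ≤ N.1 → PQuotient.mk N w = f.1 N := fun N hN => by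
    rw [← f.2 M N hN, ← hw]
    rfl
  refine ⟨FreeProP.of p w, huV fun N hN => ?_, w, ?_, rfl⟩
  · change PQuotient.mk N w ∈ u N
    rw [hwN N (hM N hN)]
    exact (hu N hN).2
  · rw [SetLike.mem_coe, MonoidHom.mem_ker, ← MonoidHom.mem_ker.1 hf]
    change QuotientGroup.kerLift (discreteTheta p k) (PQuotient.mk (discreteThetaKer p k) w) = _
    rw [hwN _ hM₀]
    rfl

theorem map_powSubgroup_le {G H : Type*} [Group G] [Group H] (f : G →* H) (p : ℕ) {P : Subgroup G}
    {Q : Subgroup H} (h : P.map f ≤ Q) : (powSubgroup p P).map f ≤ powSubgroup p Q := by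
  rw [powSubgroup, MonoidHom.map_closure, Subgroup.closure_le]
  rintro _ ⟨_, ⟨a, ha, rfl⟩, rfl⟩
  exact Subgroup.subset_closure ⟨f a, h (Subgroup.mem_map_of_mem f ha), (map_pow f a p).symm⟩

/-- The kernel is closed and contains the relators; conversely it lies in the closure of the
discrete kernel, whose generating relators map to relators of the pro-p group. -/
theorem N_eq_ker_theta (p k : ℕ) [Fact p.Prime] (hp : p ≠ 2) : N p k = (theta p k).ker := by
  refine le_antisymm ?_ ?_
  · refine Subgroup.topologicalClosure_minimal _ ?_ (isClosed_ker_theta p k)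
    refine relators_le_ker (eta p k) (theta p k) (toW_theta p k) _ ?_
    rw [xTilde, theta_of]
    simp [discreteTheta]
  · refine (ker_theta_le_topologicalClosure p k).trans (closure_mono ?_)
    rw [SetLike.coe_subset_coe, ← ker_discreteTheta p k hp, Subgroup.map_sup, Subgroup.map_sup]
    refine sup_le_sup (sup_le_sup ?_ ?_) ?_
    · rw [Subgroup.map_commutator]
      refine Subgroup.commutator_mono ?_ ?_
      · exact Subgroup.map_le_iff_le_comap.2 fun w hw => hw
      · exact Subgroup.map_le_iff_le_comap.2 fun w hw => hw
    · exact map_powSubgroup_le _ p (Subgroup.map_le_iff_le_comap.2 fun w hw => hw)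
    · refine Subgroup.map_le_iff_le_comap.2 (Subgroup.normalClosure_le_normal ?_)
      rw [Set.singleton_subset_iff]
      exact Subgroup.subset_normalClosure rfl

/-- The image of `yTilde` in `G p k`. -/
def y (p k : ℕ) [Fact p.Prime] : G p k := QuotientGroup.mk (yTilde p)

/-- The group `G p k` is generated by `x` and `y` and embeds into the Heisenberg group. -/
theorem exists_injective_hom (p k : ℕ) [Fact p.Prime] (hp : p ≠ 2) :
    Subgroup.closure {x p k, y p k} = ⊤ ∧ ∃ θ : G p k →* HeisenbergShift p (p ^ k),
      Function.Injective θ ∧ θ (x p k) = gen₀ p (p ^ k) ∧ θ (y p k) = gen₁ p (p ^ k) := by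
  have hN := N_eq_ker_theta p k hp
  constructor
  · have hxy : Subgroup.closure {x p k, y p k} =
        ((QuotientGroup.mk' (N p k)).comp (FreeProP.of p)).range := by
      rw [MonoidHom.range_eq_map, ← closure_freeGroup_generators, MonoidHom.map_closure,
        Set.image_pair]
      rfl
    rw [hxy, MonoidHom.range_eq_top]
    intro g
    obtain ⟨f, rfl⟩ := QuotientGroup.mk'_surjective _ g
    obtain ⟨w, hw, -⟩ := exists_theta_eq p k f
    refine ⟨w, QuotientGroup.eq.2 ?_⟩
    rw [hN, MonoidHom.mem_ker, map_mul, map_inv, theta_of, hw, inv_mul_cancel]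
  · refine ⟨QuotientGroup.lift (N p k) (theta p k) hN.le, ?_, ?_, ?_⟩
    · rw [injective_iff_map_eq_one]
      intro g hg
      obtain ⟨f, rfl⟩ := QuotientGroup.mk'_surjective _ g
      refine (QuotientGroup.eq_one_iff _).2 ?_
      rw [hN]
      exact hg
    · change discreteTheta p k (FreeGroup.of 0) = _
      simp [discreteTheta]
    · change discreteTheta p k (FreeGroup.of 1) = _
      simp [discreteTheta]

/-! ### Commutators of lower central terms and unipotent operators -/

theorem commutator_lowerCentralSeries_le {G : Type*} [Group G] (a b : ℕ) :
    ⁅Subgroup.lowerCentralSeries (⊤ : Subgroup G) a,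
      Subgroup.lowerCentralSeries (⊤ : Subgroup G) b⁆ ≤
        Subgroup.lowerCentralSeries (⊤ : Subgroup G) (a + b + 1) := by
  induction b generalizing a with
  | zero => exact le_rfl
  | succ b ih =>
    set K := Subgroup.lowerCentralSeries (⊤ : Subgroup G) (a + (b + 1) + 1)
    have hbot : ∀ S : Subgroup G, S.map (QuotientGroup.mk' K) = ⊥ ↔ S ≤ K := fun S => by
      rw [Subgroup.map_eq_bot_iff, QuotientGroup.ker_mk']
    rw [Subgroup.commutator_comm, Subgroup.lowerCentralSeries_succ, ← hbot,
      Subgroup.map_commutator, Subgroup.map_commutator]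
    -- The three subgroups lemma modulo K. The +1 in the bound arises because index a stands for
    -- γ_{a+1}.
    refine Subgroup.commutator_commutator_eq_bot_of_rotate ?_ ?_
    · rw [← Subgroup.map_commutator, ← Subgroup.map_commutator, hbot, Subgroup.commutator_comm ⊤]
      refine (ih (a + 1)).trans (le_of_eq ?_)
      simp only [K]
      congr 1
      ring
    · rw [← Subgroup.map_commutator, ← Subgroup.map_commutator, hbot]
      exact Subgroup.commutator_mono (ih a) le_rfl

theorem sub_one_pow_prime_pow_eq_zero {p k : ℕ} [Fact p.Prime] {X : Type*} [AddCommGroup X]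
    [Module (ZMod p) X] {σ : Module.End (ZMod p) X} (hσ : σ ^ p ^ k = 1) :
    (σ - 1) ^ p ^ k = 0 := by
  have hp0 : (p : Module.End (ZMod p) X) = 0 := by
    have := map_natCast (algebraMap (ZMod p) (Module.End (ZMod p) X)) p
    rw [← this, ZMod.natCast_self, map_zero]
  -- The p^k-th power of (σ - 1) + 1 expands additively modulo p.
  obtain ⟨r, hr⟩ := (Commute.one_right (σ - 1)).exists_add_pow_prime_pow_eq
    (Fact.out : p.Prime) k
  rw [sub_add_cancel, hσ, one_pow, hp0, zero_mul, zero_mul, zero_mul, add_zero] at hr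
  exact add_eq_right.1 hr.symm

/-! ### Difference operators and the order filtration on matrices -/

variable {p n : ℕ}

/-- Translation of vectors. -/
def vecShift (p : ℕ) {n : ℕ} (s : ZMod n) : Module.End (ZMod p) (ZMod n → ZMod p) where
  toFun v i := v (i - s)
  map_add' _ _ := rfl
  map_smul' _ _ := rfl

/-- Translation of the row index of matrices. -/
def rowShift (p : ℕ) {n : ℕ} (s : ZMod n) : Module.End (ZMod p) (ZMod n → ZMod n → ZMod p) where
  toFun m i j := m (i - s) j
  map_add' _ _ := rfl
  map_smul' _ _ := rfl

/-- Translation of the column index of matrices. -/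
def colShift (p : ℕ) {n : ℕ} (s : ZMod n) : Module.End (ZMod p) (ZMod n → ZMod n → ZMod p) where
  toFun m i j := m i (j - s)
  map_add' _ _ := rfl
  map_smul' _ _ := rfl

/-- The difference operator on vectors. -/
def vecDiff (p n : ℕ) : Module.End (ZMod p) (ZMod n → ZMod p) := vecShift p 1 - 1

/-- The difference operator in the row index. -/
def rowDiff (p n : ℕ) : Module.End (ZMod p) (ZMod n → ZMod n → ZMod p) := rowShift p 1 - 1

/-- The difference operator in the column index. -/
def colDiff (p n : ℕ) : Module.End (ZMod p) (ZMod n → ZMod n → ZMod p) := colShift p 1 - 1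

theorem vecDiff_apply (v : ZMod n → ZMod p) (i : ZMod n) :
    vecDiff p n v i = v (i - 1) - v i := rfl

theorem rowDiff_apply (m : ZMod n → ZMod n → ZMod p) (i j : ZMod n) :
    rowDiff p n m i j = m (i - 1) j - m i j := rfl

theorem colDiff_apply (m : ZMod n → ZMod n → ZMod p) (i j : ZMod n) :
    colDiff p n m i j = m i (j - 1) - m i j := rfl

theorem vecShift_pow (s : ℕ) : vecShift p (1 : ZMod n) ^ s = vecShift p (s : ZMod n) := by
  induction s with
  | zero => ext v i; simp [vecShift]
  | succ s ih =>
    rw [pow_succ, ih]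
    refine LinearMap.ext fun v => funext fun i => ?_
    simp [vecShift, sub_sub]

theorem rowShift_pow (s : ℕ) : rowShift p (1 : ZMod n) ^ s = rowShift p (s : ZMod n) := by
  induction s with
  | zero => refine LinearMap.ext fun v => funext fun i => ?_; simp [rowShift]
  | succ s ih =>
    rw [pow_succ, ih]
    refine LinearMap.ext fun v => funext fun i => ?_
    simp [rowShift, sub_sub]

theorem colShift_pow (s : ℕ) : colShift p (1 : ZMod n) ^ s = colShift p (s : ZMod n) := by
  induction s with
  | zero => refine LinearMap.ext fun v => funext fun i => ?_; simp [colShift]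
  | succ s ih =>
    rw [pow_succ, ih]
    refine LinearMap.ext fun v => funext fun i => ?_
    simp [colShift, sub_sub]

theorem vecDiff_pow_eq_zero (p k : ℕ) [Fact p.Prime] : vecDiff p (p ^ k) ^ p ^ k = 0 := by
  refine sub_one_pow_prime_pow_eq_zero ?_
  rw [vecShift_pow, ZMod.natCast_self]
  refine LinearMap.ext fun v => funext fun i => ?_
  simp [vecShift]

theorem rowDiff_pow_eq_zero (p k : ℕ) [Fact p.Prime] : rowDiff p (p ^ k) ^ p ^ k = 0 := by
  refine sub_one_pow_prime_pow_eq_zero ?_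
  rw [rowShift_pow, ZMod.natCast_self]
  refine LinearMap.ext fun v => funext fun i => ?_
  simp [rowShift]

theorem colDiff_pow_eq_zero (p k : ℕ) [Fact p.Prime] : colDiff p (p ^ k) ^ p ^ k = 0 := by
  refine sub_one_pow_prime_pow_eq_zero ?_
  rw [colShift_pow, ZMod.natCast_self]
  refine LinearMap.ext fun v => funext fun i => ?_
  simp [colShift]

theorem commute_rowDiff_colDiff : Commute (rowDiff p n) (colDiff p n) := by
  refine LinearMap.ext fun m => funext fun i => funext fun j => ?_
  change m (i - 1) (j - 1) - m (i - 1) j - (m i (j - 1) - m i j) =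
    m (i - 1) (j - 1) - m i (j - 1) - (m (i - 1) j - m i j)
  ring

theorem sub_vecShift_mem {d : ℕ} [NeZero n] {v : ZMod n → ZMod p}
    (hv : v ∈ LinearMap.range (vecDiff p n ^ d)) (s : ZMod n) :
    v - vecShift p s v ∈ LinearMap.range (vecDiff p n ^ (d + 1)) := by
  obtain ⟨t, rfl⟩ : ∃ t : ℕ, (t : ZMod n) = s := ⟨s.val, ZMod.natCast_zmod_val s⟩
  rw [← vecShift_pow]
  obtain ⟨u, rfl⟩ := hv
  -- T^t - 1 is divisible by T - 1 through the geometric sum.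
  obtain ⟨q, hq⟩ : ∃ q, vecShift p (1 : ZMod n) ^ t - 1 = vecDiff p n * q :=
    ⟨_, (mul_geom_sum (vecShift p (1 : ZMod n)) t).symm⟩
  have hc : Commute (vecShift p (1 : ZMod n) ^ t) (vecDiff p n ^ d) :=
    (((Commute.refl (vecShift p (1 : ZMod n))).sub_right (Commute.one_right _)).pow_left t).pow_right d
  refine ⟨-q u, ?_⟩
  have h1 : vecDiff p n ^ (d + 1) * q = vecShift p (1 : ZMod n) ^ t * vecDiff p n ^ d -
      vecDiff p n ^ d := by
    rw [pow_succ, mul_assoc, ← hq, mul_sub, hc.eq, mul_one]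
  have h2 := DFunLike.congr_fun h1 u
  simp only [Module.End.mul_apply, LinearMap.sub_apply] at h2
  rw [map_neg, h2, neg_sub]

/-- The filtration of the space of matrices by the total order of divisibility by the difference
operators. -/
def matFiltration (p n d : ℕ) : Submodule (ZMod p) (ZMod n → ZMod n → ZMod p) :=
  ⨆ (a : ℕ) (b : ℕ) (_ : d ≤ a + b), LinearMap.range (rowDiff p n ^ a * colDiff p n ^ b)

theorem le_matFiltration {d a b : ℕ} (h : d ≤ a + b) :
    LinearMap.range (rowDiff p n ^ a * colDiff p n ^ b) ≤ matFiltration p n d :=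
  le_iSup_of_le a (le_iSup_of_le b (le_iSup_of_le h le_rfl))

theorem matFiltration_le {d : ℕ} {S : Submodule (ZMod p) (ZMod n → ZMod n → ZMod p)}
    (h : ∀ a b, d ≤ a + b → ∀ m, (rowDiff p n ^ a * colDiff p n ^ b) m ∈ S) :
    matFiltration p n d ≤ S := by
  refine iSup_le fun a => iSup_le fun b => iSup_le fun hab => ?_
  rintro _ ⟨m, rfl⟩
  exact h a b hab m

theorem matFiltration_antitone : Antitone (matFiltration p n) := fun _ _ hde =>
  matFiltration_le fun _ _ hab m => le_matFiltration (hde.trans hab) ⟨m, rfl⟩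

theorem matFiltration_zero : matFiltration p n 0 = ⊤ :=
  top_le_iff.1 fun m _ => le_matFiltration (a := 0) (b := 0) le_rfl ⟨m, by simp⟩

theorem rowDiff_mem_matFiltration {d : ℕ} {m : ZMod n → ZMod n → ZMod p}
    (hm : m ∈ matFiltration p n d) : rowDiff p n m ∈ matFiltration p n (d + 1) := by
  have : matFiltration p n d ≤ (matFiltration p n (d + 1)).comap (rowDiff p n) := by
    refine matFiltration_le fun a b hab m => ?_
    refine le_matFiltration (a := a + 1) (b := b) (by omega) ⟨m, ?_⟩
    rw [pow_succ', mul_assoc]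
    rfl
  exact this hm

theorem colDiff_mem_matFiltration {d : ℕ} {m : ZMod n → ZMod n → ZMod p}
    (hm : m ∈ matFiltration p n d) : colDiff p n m ∈ matFiltration p n (d + 1) := by
  have : matFiltration p n d ≤ (matFiltration p n (d + 1)).comap (colDiff p n) := by
    refine matFiltration_le fun a b hab m => ?_
    refine le_matFiltration (a := a) (b := b + 1) (by omega) ⟨m, ?_⟩
    rw [pow_succ', ← mul_assoc, (commute_rowDiff_colDiff.pow_left a).eq, mul_assoc]
    rfl
  exact this hm

theorem sub_matShift_mem {d : ℕ} [NeZero n] {m : ZMod n → ZMod n → ZMod p}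
    (hm : m ∈ matFiltration p n d) (s : ZMod n) :
    (m - fun i j => m (i - s) (j - s)) ∈ matFiltration p n (d + 1) := by
  obtain ⟨t, rfl⟩ : ∃ t : ℕ, (t : ZMod n) = s := ⟨s.val, ZMod.natCast_zmod_val s⟩
  induction t generalizing m with
  | zero => convert zero_mem (matFiltration p n (d + 1)) using 1; funext i j; simp
  | succ t ih =>
    have h1 := ih hm
    have hm' : (fun i j => m (i - t) (j - t)) ∈ matFiltration p n d := by
      have := sub_mem hm (matFiltration_antitone (Nat.le_succ d) h1)
      rwa [sub_sub_cancel] at this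
    have h2 := rowDiff_mem_matFiltration hm'
    have h3 := colDiff_mem_matFiltration hm'
    have h4 := matFiltration_antitone (Nat.le_succ _) (rowDiff_mem_matFiltration h3)
    -- With row and column differences Δ_r and Δ_c, the simultaneous shift minus the identity equals
    -- Δ_r + Δ_c + Δ_r Δ_c; it is applied to the matrix already shifted by t.
    convert sub_mem (sub_mem (sub_mem h1 h2) h3) h4 using 1
    funext i j
    simp only [Pi.sub_apply, rowDiff_apply, colDiff_apply, Nat.cast_succ]
    have h5 : ∀ i : ZMod n, i - (t + 1) = i - 1 - t := fun i => by ring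
    rw [h5, h5]
    ring

/-- The alternating product of two vectors. -/
def wedge (v w : ZMod n → ZMod p) : ZMod n → ZMod n → ZMod p := fun i j => v i * w j - v j * w i

theorem rowDiff_pow_tensor (d : ℕ) (u w : ZMod n → ZMod p) :
    (rowDiff p n ^ d) (fun i j => u i * w j) = fun i j => (vecDiff p n ^ d) u i * w j := by
  induction d with
  | zero => rfl
  | succ d ih =>
    rw [pow_succ', pow_succ', Module.End.mul_apply, ih]
    funext i j
    rw [rowDiff_apply, Module.End.mul_apply, vecDiff_apply, sub_mul]

theorem colDiff_pow_tensor (d : ℕ) (u w : ZMod n → ZMod p) :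
    (colDiff p n ^ d) (fun i j => u j * w i) = fun i j => (vecDiff p n ^ d) u j * w i := by
  induction d with
  | zero => rfl
  | succ d ih =>
    rw [pow_succ', pow_succ', Module.End.mul_apply, ih]
    funext i j
    rw [colDiff_apply, Module.End.mul_apply, vecDiff_apply, sub_mul]

theorem wedge_mem_matFiltration {d : ℕ} {v : ZMod n → ZMod p}
    (hv : v ∈ LinearMap.range (vecDiff p n ^ d)) (w : ZMod n → ZMod p) :
    wedge v w ∈ matFiltration p n d := by
  obtain ⟨u, rfl⟩ := hv
  refine sub_mem (S := Submodule (ZMod p) (ZMod n → ZMod n → ZMod p))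
    (x := fun i j => (vecDiff p n ^ d) u i * w j) (y := fun i j => (vecDiff p n ^ d) u j * w i)
    ?_ ?_
  · rw [← rowDiff_pow_tensor]
    exact le_matFiltration (a := d) (b := 0) le_rfl ⟨_, by rw [pow_zero, mul_one]⟩
  · rw [← colDiff_pow_tensor]
    exact le_matFiltration (a := 0) (b := d) (by omega) ⟨_, by rw [pow_zero, one_mul]⟩

/-- If a + b ≥ 2q - 2 with q = p^k, then a + 1 ≥ q or b ≥ q, so one more row difference annihilates
every generator of the filtration. -/
theorem eq_of_mem_matFiltration {k : ℕ} [Fact p.Prime]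
    {m : ZMod (p ^ k) → ZMod (p ^ k) → ZMod p}
    (hm : m ∈ matFiltration p (p ^ k) (2 * p ^ k - 2)) (i j : ZMod (p ^ k)) :
    m (i - 1) j = m i j := by
  have hpos : 0 < p ^ k := pow_pos (Fact.out : p.Prime).pos k
  have : matFiltration p (p ^ k) (2 * p ^ k - 2) ≤ LinearMap.ker (rowDiff p (p ^ k)) := by
    refine matFiltration_le fun a b hab m => ?_
    rw [LinearMap.mem_ker, ← Module.End.mul_apply, ← mul_assoc, ← pow_succ']
    rcases le_or_gt (p ^ k) (a + 1) with h | h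
    · rw [pow_eq_zero_of_le h (rowDiff_pow_eq_zero p k), zero_mul, LinearMap.zero_apply]
    · rw [pow_eq_zero_of_le (show p ^ k ≤ b by omega) (colDiff_pow_eq_zero p k), mul_zero,
        LinearMap.zero_apply]
  have h := congrFun (congrFun (LinearMap.mem_ker.1 (this hm)) i) j
  rw [rowDiff_apply] at h
  exact sub_eq_zero.1 h

/-! ### A central filtration of the model -/

namespace HeisenbergShift

/-- The elements whose matrix has zero diagonal. -/
def hollow (p n : ℕ) : Subgroup (HeisenbergShift p n) where
  carrier := {a | ∀ i, a.mat i i = 0}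
  one_mem' _ := rfl
  mul_mem' {a b} ha hb i := by
    rw [mat_mul, ha i, hb (i - a.shift)]
    ring
  inv_mem' {a} ha i := by
    rw [mat_inv, ha (i + a.shift), neg_zero]

/-- A central filtration of the group of hollow elements. -/
def filtration (p n d : ℕ) : Subgroup (HeisenbergShift p n) where
  carrier := {a | a.shift = 0 ∧ a.vec ∈ LinearMap.range (vecDiff p n ^ (d + 1)) ∧
    a.mat ∈ matFiltration p n d ∧ a ∈ hollow p n}
  one_mem' := ⟨rfl, zero_mem _, zero_mem _, one_mem _⟩
  mul_mem' {a b} ha hb := by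
    refine ⟨by rw [shift_mul, ha.1, hb.1, add_zero], ?_, ?_, mul_mem ha.2.2.2 hb.2.2.2⟩
    · convert add_mem ha.2.1 hb.2.1 using 1
      funext i
      simp [ha.1]
    · convert add_mem (add_mem ha.2.2.1 hb.2.2.1) (matFiltration_antitone (Nat.le_succ d)
        (wedge_mem_matFiltration ha.2.1 b.vec)) using 1
      funext i j
      simp [ha.1, wedge]
  inv_mem' {a} ha := by
    refine ⟨by rw [shift_inv, ha.1, neg_zero], ?_, ?_, inv_mem ha.2.2.2⟩
    · convert neg_mem ha.2.1 using 1
      funext i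
      simp [ha.1]
    · convert neg_mem ha.2.2.1 using 1
      funext i j
      simp [ha.1]

theorem shift_commutator (g h : HeisenbergShift p n) : ⁅g, h⁆.shift = 0 := by
  simp [commutatorElement_def]

theorem commutator_mul_mul (g h : HeisenbergShift p n) : ⁅g, h⁆ * (h * g) = g * h := by
  rw [commutatorElement_def]
  group

theorem vec_commutator (g h : HeisenbergShift p n) :
    ⁅g, h⁆.vec = (g.vec - vecShift p h.shift g.vec) - (h.vec - vecShift p g.shift h.vec) := by
  funext i
  have h1 := congrFun (congrArg vec (commutator_mul_mul g h)) i
  simp only [vec_mul, shift_commutator, sub_zero] at h1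
  simp only [Pi.sub_apply, vecShift, LinearMap.coe_mk, AddHom.coe_mk]
  linear_combination h1

theorem mat_commutator {g : HeisenbergShift p n} (hg : g.shift = 0) (h : HeisenbergShift p n) :
    ⁅g, h⁆.mat = (g.mat - fun i j => g.mat (i - h.shift) (j - h.shift)) +
      (2 : ZMod p) • wedge (vecShift p h.shift g.vec) h.vec -
        wedge g.vec (vecShift p h.shift g.vec) := by
  funext i j
  have h1 := congrFun (congrFun (congrArg mat (commutator_mul_mul g h)) i) j
  have h2 : ∀ i, ⁅g, h⁆.vec i = g.vec i - g.vec (i - h.shift) := fun i => by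
    rw [vec_commutator, hg]
    simp [vecShift]
  simp only [mat_mul, vec_mul, shift_commutator, sub_zero, hg, h2] at h1
  simp only [Pi.sub_apply, Pi.add_apply, Pi.smul_apply, smul_eq_mul, wedge, vecShift,
    LinearMap.coe_mk, AddHom.coe_mk]
  linear_combination h1

theorem commutator_mem {H : Type*} [Group H] {K : Subgroup H} {g h : H} (hg : g ∈ K)
    (hh : h ∈ K) : ⁅g, h⁆ ∈ K := by
  rw [commutatorElement_def]
  exact mul_mem (mul_mem (mul_mem hg hh) (inv_mem hg)) (inv_mem hh)

theorem commutator_hollow_le [NeZero n] :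
    ⁅hollow p n, hollow p n⁆ ≤ filtration p n 0 := by
  refine Subgroup.commutator_le.2 fun g hg h hh =>
    ⟨shift_commutator g h, ?_, ?_, commutator_mem hg hh⟩
  · rw [vec_commutator]
    have ht : ∀ v : ZMod n → ZMod p, v ∈ LinearMap.range (vecDiff p n ^ 0) := fun v => ⟨v, rfl⟩
    exact sub_mem (sub_vecShift_mem (ht _) _) (sub_vecShift_mem (ht _) _)
  · rw [matFiltration_zero]
    trivial

/-- Vectors are kept one order ahead of matrices: a vector of order d + 1 wedged with an arbitrary
vector already has matrix order d + 1, while the shift terms gain one order by themselves. -/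
theorem commutator_filtration_le [NeZero n] (d : ℕ) :
    ⁅filtration p n d, hollow p n⁆ ≤ filtration p n (d + 1) := by
  refine Subgroup.commutator_le.2 fun g hg h hh =>
    ⟨shift_commutator g h, ?_, ?_, commutator_mem hg.2.2.2 hh⟩
  · rw [vec_commutator, hg.1]
    convert sub_vecShift_mem hg.2.1 h.shift using 1
    funext i
    simp [vecShift]
  · rw [mat_commutator hg.1]
    have hs : vecShift p h.shift g.vec ∈ LinearMap.range (vecDiff p n ^ (d + 1)) := by
      obtain ⟨u, hu⟩ := sub_vecShift_mem hg.2.1 h.shift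
      have : g.vec - vecShift p h.shift g.vec ∈ LinearMap.range (vecDiff p n ^ (d + 1)) :=
        ⟨vecDiff p n u, by rw [← Module.End.mul_apply, ← pow_succ, hu]⟩
      have := sub_mem hg.2.1 this
      rwa [sub_sub_cancel] at this
    exact sub_mem (add_mem (sub_matShift_mem hg.2.2.1 h.shift)
      (Submodule.smul_mem _ _ (wedge_mem_matFiltration hs _))) (wedge_mem_matFiltration hg.2.1 _)

/-- The vector vanishes because Δ^q = 0 for q = p^k. The matrix is constant down each column, and
its diagonal entry there is zero. -/
theorem filtration_eq_bot (p k : ℕ) [Fact p.Prime] :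
    filtration p (p ^ k) (2 * p ^ k - 2) = ⊥ := by
  have hpos : 0 < p ^ k := pow_pos (Fact.out : p.Prime).pos k
  have : NeZero (p ^ k) := ⟨hpos.ne'⟩
  rw [eq_bot_iff]
  rintro g ⟨hs, hv, hm, hd⟩
  rw [pow_eq_zero_of_le (show p ^ k ≤ 2 * p ^ k - 2 + 1 by omega) (vecDiff_pow_eq_zero p k),
    LinearMap.range_zero] at hv
  have hconst : ∀ (t : ℕ) (i j : ZMod (p ^ k)), g.mat (i - t) j = g.mat i j := by
    intro t i j
    induction t with
    | zero => simp
    | succ t ih => rw [Nat.cast_succ, ← sub_sub, eq_of_mem_matFiltration hm, ih]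
  refine ext' hs (fun i => congrFun hv i) fun i j => ?_
  have h1 := hconst (i - j).val i j
  rw [ZMod.natCast_zmod_val, sub_sub_cancel, hd j] at h1
  rw [← h1, mat_one]

end HeisenbergShift

/-! ### The exact nilpotency class -/

open HeisenbergShift

theorem range_le_hollow {G : Type*} [Group G] {x y : G} (hG : Subgroup.closure {x, y} = ⊤)
    {θ : G →* HeisenbergShift p n} (hθx : θ x = gen₀ p n) (hθy : θ y = gen₁ p n) (g : G) :
    θ g ∈ hollow p n := by
  have h : Subgroup.closure {x, y} ≤ (hollow p n).comap θ := by
    rw [Subgroup.closure_le]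
    rintro _ (rfl | rfl)
    · rw [SetLike.mem_coe, Subgroup.mem_comap, hθx]
      exact fun _ => rfl
    · rw [SetLike.mem_coe, Subgroup.mem_comap, hθy]
      exact fun _ => rfl
  exact h (hG ▸ Subgroup.mem_top g)

theorem lowerCentralSeries_le_filtration [NeZero n] {G : Type*} [Group G]
    {θ : G →* HeisenbergShift p n} (hθ : ∀ g, θ g ∈ hollow p n) (d : ℕ) :
    Subgroup.lowerCentralSeries (⊤ : Subgroup G) (d + 1) ≤ (filtration p n d).comap θ := by
  induction d with
  | zero =>
    refine Subgroup.commutator_le.2 fun g _ h _ => ?_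
    rw [Subgroup.mem_comap, map_commutatorElement]
    exact commutator_hollow_le (Subgroup.commutator_mem_commutator (hθ g) (hθ h))
  | succ d ih =>
    refine Subgroup.commutator_le.2 fun g hg h _ => ?_
    rw [Subgroup.mem_comap, map_commutatorElement]
    exact commutator_filtration_le d (Subgroup.commutator_mem_commutator (ih hg) (hθ h))

theorem lowerCentralSeries_eq_bot {k : ℕ} [Fact p.Prime] {G : Type*} [Group G]
    {θ : G →* HeisenbergShift p (p ^ k)} (hinj : Function.Injective θ)
    (hθ : ∀ g, θ g ∈ hollow p (p ^ k)) :
    Subgroup.lowerCentralSeries (⊤ : Subgroup G) (2 * p ^ k - 1) = ⊥ := by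
  have hpos : 0 < p ^ k := pow_pos (Fact.out : p.Prime).pos k
  have : NeZero (p ^ k) := ⟨hpos.ne'⟩
  have h := lowerCentralSeries_le_filtration hθ (2 * p ^ k - 2)
  rw [filtration_eq_bot, show 2 * p ^ k - 2 + 1 = 2 * p ^ k - 1 by omega] at h
  rw [eq_bot_iff]
  intro g hg
  exact hinj ((h hg).trans (map_one θ).symm)

/-- The iterated commutator `[x, [x, …, [x, y]]]`. -/
def engel {G : Type*} [Group G] (x y : G) : ℕ → G
  | 0 => y
  | i + 1 => ⁅x, engel x y i⁆

theorem engel_mem_lowerCentralSeries {G : Type*} [Group G] (x y : G) (i : ℕ) :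
    engel x y i ∈ Subgroup.lowerCentralSeries (⊤ : Subgroup G) i := by
  induction i with
  | zero => exact Subgroup.mem_top _
  | succ i ih =>
    rw [Subgroup.lowerCentralSeries_succ, Subgroup.commutator_comm]
    exact Subgroup.commutator_mem_commutator (Subgroup.mem_top _) ih

theorem map_engel {G H : Type*} [Group G] [Group H] (f : G →* H) (x y : G) (i : ℕ) :
    f (engel x y i) = engel (f x) (f y) i := by
  induction i with
  | zero => rfl
  | succ i ih => rw [engel, engel, map_commutatorElement, ih]

theorem engel_gen (i : ℕ) : (engel (gen₀ p n) (gen₁ p n) i).shift = 0 ∧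
    (engel (gen₀ p n) (gen₁ p n) i).vec = (vecDiff p n ^ i) (Pi.single 0 1) := by
  induction i with
  | zero => exact ⟨rfl, rfl⟩
  | succ i ih =>
    refine ⟨shift_commutator _ _, ?_⟩
    rw [engel, vec_commutator, ih.1, ih.2, pow_succ', Module.End.mul_apply]
    funext j
    simp [gen₀, vecShift, vecDiff]

/-- Identifying δ_i with T^i, the vector is (T - 1)^d, monic of degree d; no wrap-around occurs
because d < n. -/
theorem vecDiff_pow_single (d j : ℕ) (hdj : d ≤ j) (hj : j < n) :
    (vecDiff p n ^ d) (Pi.single 0 1) (j : ZMod n) = if j = d then 1 else 0 := by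
  induction d generalizing j with
  | zero =>
    have : (j : ZMod n) = 0 ↔ j = 0 := by
      rw [ZMod.natCast_eq_zero_iff]
      exact ⟨fun h => Nat.eq_zero_of_dvd_of_lt h hj, fun h => h ▸ dvd_zero n⟩
    simp [Pi.single_apply, this]
  | succ d ih =>
    obtain ⟨j, rfl⟩ : ∃ i, j = i + 1 := ⟨j - 1, by omega⟩
    rw [pow_succ', Module.End.mul_apply, vecDiff_apply, Nat.cast_succ, add_sub_cancel_right,
      ih j (by omega) (by omega), ← Nat.cast_succ, ih (j + 1) (by omega) hj]
    simp [show j + 1 ≠ d by omega]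

theorem lowerCentralSeries_ne_bot {G : Type*} [Group G] {x y : G} [Fact p.Prime] (hp : p ≠ 2)
    {θ : G →* HeisenbergShift p n} (hθx : θ x = gen₀ p n) (hθy : θ y = gen₁ p n) (hn : 2 ≤ n) :
    Subgroup.lowerCentralSeries (⊤ : Subgroup G) (2 * n - 2) ≠ ⊥ := by
  intro hbot
  have h1 : ⁅engel x y (n - 2), engel x y (n - 1)⁆ ∈
      Subgroup.lowerCentralSeries (⊤ : Subgroup G) (2 * n - 2) := by
    have := commutator_lowerCentralSeries_le (n - 2) (n - 1)
      (Subgroup.commutator_mem_commutator (engel_mem_lowerCentralSeries x y (n - 2))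
        (engel_mem_lowerCentralSeries x y (n - 1)))
    rwa [show n - 2 + (n - 1) + 1 = 2 * n - 2 by omega] at this
  rw [hbot, Subgroup.mem_bot] at h1
  have h2 := congrArg θ h1
  rw [map_commutatorElement, map_engel, map_engel, hθx, hθy, map_one] at h2
  -- At position (n - 2, n - 1) the two vectors have the triangular values 1, 0 and *, 1, so their
  -- wedge is 1 and the commutator entry is 2.
  have h3 := congrFun (congrFun (congrArg mat h2) ((n - 2 : ℕ) : ZMod n)) ((n - 1 : ℕ) : ZMod n)
  rw [mat_commutator (engel_gen _).1, (engel_gen (n - 1)).1, (engel_gen (n - 1)).2,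
    (engel_gen (n - 2)).2] at h3
  have e₁ := vecDiff_pow_single (p := p) (n := n) (n - 2) (n - 2) le_rfl (by omega)
  have e₂ := vecDiff_pow_single (p := p) (n := n) (n - 2) (n - 1) (by omega) (by omega)
  have e₃ := vecDiff_pow_single (p := p) (n := n) (n - 1) (n - 1) le_rfl (by omega)
  rw [if_pos rfl] at e₁ e₃
  rw [if_neg (by omega)] at e₂
  simp [wedge, vecShift, e₁, e₂, e₃] at h3
  have h4 : ((2 : ℕ) : ZMod p) = 0 := by exact_mod_cast h3
  rw [ZMod.natCast_eq_zero_iff] at h4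
  exact hp ((Nat.prime_dvd_prime_iff_eq Fact.out Nat.prime_two).1 h4)

/-! ### The lower p-series in terms of the lower central series -/

theorem commutatorElement_pow_left_of_commute {G : Type*} [Group G] {w g : G}
    (h : Commute ⁅w, g⁆ w) (m : ℕ) : ⁅w ^ m, g⁆ = ⁅w, g⁆ ^ m := by
  induction m with
  | zero => simp
  | succ m ih =>
    have h1 : ⁅w ^ (m + 1), g⁆ = w ^ m * ⁅w, g⁆ * (w ^ m)⁻¹ * ⁅w ^ m, g⁆ := by
      simp only [commutatorElement_def, pow_succ]
      group
    rw [h1, ← (h.pow_right m).eq, mul_inv_cancel_right, ih, pow_succ']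

theorem mul_pow_mem_of_commutator_mem {G : Type*} [Group G] {K S : Subgroup G} [K.Normal]
    (hKS : K ≤ S) {a b : G} (hab : ⁅a, b⁆ ∈ K) {m : ℕ} (ha : a ^ m ∈ S) (hb : b ^ m ∈ S) :
    (a * b) ^ m ∈ S := by
  have hc : Commute (QuotientGroup.mk' K a) (QuotientGroup.mk' K b) := by
    rw [← commutatorElement_eq_one_iff_commute, ← map_commutatorElement]
    exact (QuotientGroup.eq_one_iff _).2 hab
  have h1 : QuotientGroup.mk' K (a ^ m * b ^ m) = QuotientGroup.mk' K ((a * b) ^ m) := by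
    rw [map_mul, map_pow, map_pow, map_pow, map_mul, hc.mul_pow]
  have h2 : (a ^ m * b ^ m)⁻¹ * (a * b) ^ m ∈ S := hKS (QuotientGroup.eq.1 h1)
  exact (Subgroup.mul_mem_cancel_left S (inv_mem (mul_mem ha hb))).1 h2

section LowerPSeries

variable {G : Type*} [Group G] {p : ℕ} {x y : G}

/-- Modulo the next term, w = x^(p^j) commutes with [w, g], so [w^p, g] = [w, g]^p, which is trivial
because γ_2 has exponent dividing p. Each p-th power of x thus gains one step. -/
theorem commutator_pow_prime_pow_mem
    (hpow : ∀ g ∈ Subgroup.lowerCentralSeries (⊤ : Subgroup G) 1, g ^ p = 1) (x g : G) (j : ℕ) :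
    ⁅x ^ p ^ j, g⁆ ∈ Subgroup.lowerCentralSeries (⊤ : Subgroup G) (j + 1) := by
  induction j generalizing g with
  | zero => exact Subgroup.commutator_mem_commutator (Subgroup.mem_top _) (Subgroup.mem_top _)
  | succ j ih =>
    set K := Subgroup.lowerCentralSeries (⊤ : Subgroup G) (j + 1 + 1)
    have hc : Commute ⁅QuotientGroup.mk' K (x ^ p ^ j), QuotientGroup.mk' K g⁆
        (QuotientGroup.mk' K (x ^ p ^ j)) := by
      rw [← map_commutatorElement, ← commutatorElement_eq_one_iff_commute,
        ← map_commutatorElement]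
      exact (QuotientGroup.eq_one_iff _).2
        (Subgroup.commutator_mem_commutator (ih g) (Subgroup.mem_top _))
    refine (QuotientGroup.eq_one_iff _).1 ?_
    change QuotientGroup.mk' K ⁅x ^ p ^ (j + 1), g⁆ = 1
    rw [map_commutatorElement, pow_succ, pow_mul, map_pow, commutatorElement_pow_left_of_commute hc,
      ← map_commutatorElement, ← map_pow,
      hpow _ (Subgroup.lowerCentralSeries_antitone ⊤ (Nat.le_add_left 1 j) (ih g)), map_one]

/-- In a group generated by `x` and an element of order dividing `p` whose derived subgroup has
exponent dividing `p`, the lower `p`-series is determined by the lower central series. -/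
theorem lowerPSeries_eq_sup (hG : Subgroup.closure {x, y} = ⊤) (hy : y ^ p = 1)
    (hpow : ∀ g ∈ Subgroup.lowerCentralSeries (⊤ : Subgroup G) 1, g ^ p = 1) (i : ℕ) :
    lowerPSeries p G (i + 1) =
      Subgroup.zpowers (x ^ p ^ i) ⊔ Subgroup.lowerCentralSeries (⊤ : Subgroup G) i := by
  induction i with
  | zero => exact (top_le_iff.1 le_sup_right).symm
  | succ i ih =>
    rw [lowerPSeries, ih]
    refine le_antisymm (sup_le ?_ ?_) (sup_le ?_ ?_)
    · refine (Subgroup.closure_le _).2 ?_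
      rintro _ ⟨h, hh, rfl⟩
      rw [SetLike.mem_coe]
      -- For i = 0 the lower central term is all of G, where the exponent hypothesis is unavailable;
      -- p-th powers are then computed on generators modulo γ_2.
      rcases Nat.eq_zero_or_pos i with rfl | hi
      · clear hh
        have hmem : h ∈ Subgroup.closure {x, y} := hG ▸ Subgroup.mem_top h
        induction hmem using Subgroup.closure_induction with
        | mem _ hz =>
          rcases hz with rfl | rfl
          · refine Subgroup.mem_sup_left ?_
            simp
          · rw [hy]
            exact one_mem _
        | one => rw [one_pow]; exact one_mem _
        | mul a b _ _ iha ihb =>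
          exact mul_pow_mem_of_commutator_mem le_sup_right (Subgroup.commutator_mem_commutator
            (Subgroup.mem_top a) (Subgroup.mem_top b)) iha ihb
        | inv a _ iha => rw [inv_pow]; exact inv_mem iha
      · obtain ⟨_, ⟨a, rfl⟩, g, hg, rfl⟩ := Subgroup.mem_sup_of_normal_right.1 hh
        refine mul_pow_mem_of_commutator_mem le_sup_right
          (b := g) (K := Subgroup.lowerCentralSeries (⊤ : Subgroup G) (i + 1)) ?_ ?_ ?_
        · rw [Subgroup.lowerCentralSeries_succ, Subgroup.commutator_comm]
          exact Subgroup.commutator_mem_commutator (Subgroup.mem_top _) hg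
        · refine Subgroup.mem_sup_left ⟨a, ?_⟩
          change (x ^ p ^ (i + 1)) ^ a = ((x ^ p ^ i) ^ a) ^ p
          rw [pow_succ p i, pow_mul, ← zpow_natCast _ p, ← zpow_natCast ((x ^ p ^ i) ^ a) p,
            ← zpow_mul, ← zpow_mul, mul_comm]
        · rw [hpow g (Subgroup.lowerCentralSeries_antitone ⊤ hi hg)]
          exact one_mem _
    · refine le_trans ?_ le_sup_right
      -- Both factors are central modulo the next lower central term, hence so is their join.
      have hle : Subgroup.zpowers (x ^ p ^ i) ⊔ Subgroup.lowerCentralSeries (⊤ : Subgroup G) i ≤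
          (Subgroup.center (G ⧸ Subgroup.lowerCentralSeries (⊤ : Subgroup G) (i + 1))).comap
            (QuotientGroup.mk' _) := by
        have hcen : ∀ h : G, (∀ g, ⁅h, g⁆ ∈ Subgroup.lowerCentralSeries (⊤ : Subgroup G) (i + 1)) →
            h ∈ (Subgroup.center (G ⧸ Subgroup.lowerCentralSeries (⊤ : Subgroup G) (i + 1))).comap
              (QuotientGroup.mk' _) := by
          intro h hh
          refine Subgroup.mem_center_iff.2 fun q => ?_
          obtain ⟨g, rfl⟩ := QuotientGroup.mk'_surjective _ q
          refine Eq.symm (commutatorElement_eq_one_iff_mul_comm.1 ?_)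
          rw [← map_commutatorElement]
          exact (QuotientGroup.eq_one_iff _).2 (hh g)
        refine sup_le ?_ fun h hh => hcen h fun g =>
          Subgroup.commutator_mem_commutator hh (Subgroup.mem_top g)
        rw [Subgroup.zpowers_le]
        exact hcen _ fun g => commutator_pow_prime_pow_mem hpow x g i
      refine Subgroup.commutator_le.2 fun h hh g _ => ?_
      refine (QuotientGroup.eq_one_iff _).1 ?_
      change QuotientGroup.mk' _ ⁅h, g⁆ = 1
      rw [map_commutatorElement, commutatorElement_eq_one_iff_mul_comm]
      exact (Subgroup.mem_center_iff.1 (hle hh) _).symm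
    · rw [Subgroup.zpowers_le]
      refine Subgroup.mem_sup_left (Subgroup.subset_closure
        ⟨x ^ p ^ i, Subgroup.mem_sup_left (Subgroup.mem_zpowers _), ?_⟩)
      rw [pow_succ, pow_mul]
    · exact le_sup_of_le_right (Subgroup.commutator_mono le_sup_right le_rfl)

end LowerPSeries

end ProPWreath

/-! ### Length and terms of the lower p-series of G_k -/

open ProPWreath ProPWreath.HeisenbergShift in
/-- The lower `p`-series of `G p k` has length `2 p ^ k - 1`, and its terms are the products of the
subgroups generated by the powers `x ^ (p ^ (i - 1))` with the terms of the lower central series. -/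
theorem proposition3p6 (p : ℕ) [Fact p.Prime] (hp : Odd p) (k : ℕ) (hk : 1 ≤ k) :
    IsLeast {n : ℕ | ProPWreath.lowerPSeries p (ProPWreath.G p k) (n + 1) = ⊥} (2 * p ^ k - 1) ∧
    ∀ i : ℕ, 1 ≤ i → i ≤ 2 * p ^ k - 1 →
      (ProPWreath.lowerPSeries p (ProPWreath.G p k) i : Set (ProPWreath.G p k)) =
        {g | ∃ a ∈ Subgroup.zpowers (ProPWreath.x p k ^ p ^ (i - 1)),
          ∃ b ∈ Subgroup.lowerCentralSeries (⊤ : Subgroup (ProPWreath.G p k)) (i - 1),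
            a * b = g} := by
  have hp2 : p ≠ 2 := by
    rintro rfl
    exact absurd hp (by decide)
  have hk' : k < p ^ k := Nat.lt_pow_self (Fact.out : p.Prime).one_lt
  have : NeZero (p ^ k) := ⟨by omega⟩
  obtain ⟨hG, θ, hinj, hθx, hθy⟩ := exists_injective_hom p k hp2
  have hθ := range_le_hollow hG hθx hθy
  have hexp : ∀ g, (θ g).shift = 0 → g ^ p = 1 := fun g hg => by
    apply hinj
    rw [map_pow, pow_char_eq_one_of_shift_eq_zero hg, map_one]
  have hP := lowerPSeries_eq_sup hG (hexp _ (by rw [hθy]; rfl))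
    (fun g hg => hexp g (lowerCentralSeries_le_filtration hθ 0 hg).1)
  have hx : x p k ^ p ^ k = 1 := by
    apply hinj
    rw [map_pow, hθx, gen₀_pow_self, map_one]
  refine ⟨⟨?_, fun m hm => ?_⟩, fun i hi _ => ?_⟩
  · rw [Set.mem_ofPred_eq, hP, lowerCentralSeries_eq_bot hinj hθ, sup_bot_eq,
      Subgroup.zpowers_eq_bot]
    -- x^(p^k) = 1 and k ≤ 2p^k - 1, so the cyclic factor dies no later than the lower central
    -- factor.
    obtain ⟨c, hc⟩ := pow_dvd_pow p (show k ≤ 2 * p ^ k - 1 by omega)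
    rw [hc, pow_mul, hx, one_pow]
  · rw [Set.mem_ofPred_eq, hP] at hm
    by_contra hlt
    refine lowerCentralSeries_ne_bot hp2 hθx hθy (by omega) ?_
    rw [eq_bot_iff, ← hm]
    exact (Subgroup.lowerCentralSeries_antitone ⊤ (by omega)).trans le_sup_right
  · obtain ⟨j, rfl⟩ : ∃ j, i = j + 1 := ⟨i - 1, by omega⟩
    ext g
    rw [SetLike.mem_coe, hP, Nat.add_sub_cancel]
    exact Subgroup.mem_sup_of_normal_right
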